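/- Let $G$ be a finitely generated group with a finite symmetric generating set $S$, and let $B_G(n)$ be the ball of radius $n$ around the identity for the associated word metric. For a $G$-set $X$ put $\mathrm{vol}_{G,X}(n)=\max_{x\in X}|B_G(n)\cdot x|$ (with value $0$ if $X=\emptyset$). Let $\mathcal C(\mathrm{lin})$ be the class of finitely generated groups $G$ that admit a faithful action of (at most) linear growth, i.e. a faithful $G$-set $X$ for which there is a constant $C>0$ such that $\mathrm{vol}_{G,X}(n)\le Cn$ for all $n\ge 1$; this does not depend on the choice of $S$. For a finite simple graph $\Gamma$ with vertex set $I$ and a family of groups $(G_i)_{i\in I}$, the graph product of the $G_i$ along $\Gamma$ is the quotient of the free product $\ast_{i\in I}G_i$ by the normal closure of all commutators $[g,h]$ with $g\in G_i$, $h\in G_j$ and $i,j$ adjacent in $\Gamma$. For an arbitrary simple graph $\Gamma$, the right-angled Artin group of $\Gamma$ is the group with one generator for each vertex and the relations that two generators commute when the corresponding vertices are adjacent. The Grigorchuk group is the group of automorphisms of the rooted binary tree $\{0,1\}^*$ generated by $a,b,c,d$, which fix the empty word and satisfy $$a(0w)=1w,\ a(1w)=0w;\quad b(0w)=0a(w),\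 b(1w)=1c(w);\quad c(0w)=0a(w),\ c(1w)=1d(w);\quad d(0w)=0w,\ d(1w)=1b(w).$$ **Proposition 1.2.** Let $(G_i)_{i\in I}$ be a finite family of groups such that each $G_i$ is isomorphic to one of the following: - a finite group; - a finitely generated abelian group; - a finitely generated subgroup of a right-angled Artin group; - the Grigorchuk group; - the lamplighter group $(\mathbb Z/p\mathbb Z)\wr\mathbb Z=\left(\bigoplus_{\mathbb Z}\mathbb Z/p\mathbb Z\right)\rtimes\mathbb Z$ for some integer $p\ge 2$. Then the free product $\ast_{i\in I}G_i$ belongs to $\mathcal C(\mathrm{lin})$. More generally, for every simple graph $\Gamma$ with vertex set $I$, the graph product of the $G_i$ along $\Gamma$ belongs to $\mathcal C(\mathrm{lin})$. -/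

import Mathlib

universe u v w

noncomputable section

namespace ActionGrowth

/-! ## Growth of actions -/

/-- `S` is a finite symmetric generating set of the group `G`. -/
structure IsFiniteSymmGenSet {G : Type u} [Group G] (S : Set G) : Prop where
  finite : S.Finite
  symm : ∀ s ∈ S, s⁻¹ ∈ S
  closure_eq_top : Subgroup.closure S = ⊤

/-- The ball of radius `n` around the identity for the word metric associated to the symmetric
generating set `S`: all products of at most `n` elements of `S`. -/
def wordBall {G : Type u} [Group G] (S : Set G) (n : ℕ) : Set G :=
  {g | ∃ l : List G, l.length ≤ n ∧ (∀ s ∈ l, s ∈ S) ∧ l.prod = g}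

/-- The volume of the largest ball of radius `n` in the Schreier graph of the action of `G` on `X`
(with respect to `S`), that is `max_x |B_G(n) • x|`. When `S` is finite the cardinalities are finite
and bounded by that of `B_G(n)`, so that the supremum is a maximum as soon as `X` is nonempty. -/
def vol {G : Type u} [Group G] (S : Set G) (X : Type v) [MulAction G X] (n : ℕ) : ℕ :=
  ⨆ x : X, ((fun g : G => g • x) '' wordBall S n).ncard

/-- `f₁ ≼ f₂`: there is `C > 0` such that `f₁ n ≤ C f₂ (C n)` for all `n ≥ 1`.
(The radius `n = 0` is left out, so that `n ↦ n` is an admissible bound: balls of radius `0` have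
one point.) -/
def GrowthLE (f₁ f₂ : ℕ → ℕ) : Prop :=
  ∃ C : ℕ, 0 < C ∧ ∀ n : ℕ, 1 ≤ n → f₁ n ≤ C * f₂ (C * n)

/-- The class `C(f)`: finitely generated groups `G` that admit a faithful `G`-set `X` whose growth
satisfies `vol_{G, X} ≼ f`. The growth bound is required for all finite symmetric generating sets
(equivalently, for one of them). -/
def ClassC (f : ℕ → ℕ) (G : Type u) [Group G] : Prop :=
  Group.FG G ∧
    ∃ (X : Type u) (_ : MulAction G X), FaithfulSMul G X ∧
      ∀ S : Set G, IsFiniteSymmGenSet S → GrowthLE (vol S X) f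

/-- The class `C(lin)` of finitely generated groups with a faithful action of linear growth. -/
def ClassCLin (G : Type u) [Group G] : Prop :=
  ClassC (fun n => n) G

/-! ## Graph products -/

/-- The commutators `[g, h]` in the free product of the `G i`, where `g ∈ G i`, `h ∈ G j` and
`i, j` are adjacent. -/
def graphProductRels {ι : Type w} (Γ : SimpleGraph ι) (G : ι → Type u) [∀ i, Group (G i)] :
    Set (Monoid.CoprodI G) :=
  {x | ∃ i j : ι, Γ.Adj i j ∧ ∃ (g : G i) (h : G j),
    x = Monoid.CoprodI.of g * Monoid.CoprodI.of h *
      (Monoid.CoprodI.of g)⁻¹ * (Monoid.CoprodI.of h)⁻¹}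

/-- The graph product of the groups `G i` along the simple graph `Γ`: the quotient of the free
product by the relations `[G i, G j] = 1` for all adjacent `i, j`. -/
abbrev GraphProduct {ι : Type w} (Γ : SimpleGraph ι) (G : ι → Type u) [∀ i, Group (G i)] :
    Type (max w u) :=
  Monoid.CoprodI G ⧸ Subgroup.normalClosure (graphProductRels Γ G)

/-- The right-angled Artin group of `Γ`: the graph product along `Γ` of infinite cyclic groups,
i.e. one generator for each vertex, two generators commuting when the vertices are adjacent. -/
abbrev RAAG {V : Type v} (Γ : SimpleGraph V) : Type v :=
  GraphProduct Γ (fun _ : V => Multiplicative ℤ)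

/-! ## The Grigorchuk group

The vertices of the rooted binary tree are the finite binary words, `false` standing for the
digit `0` and `true` for the digit `1`. -/

/-- `a(0w) = 1w`, `a(1w) = 0w`. -/
def grigAFun : List Bool → List Bool
  | [] => []
  | x :: t => (!x) :: t

mutual

/-- `b(0w) = 0a(w)`, `b(1w) = 1c(w)`. -/
def grigBFun : List Bool → List Bool
  | [] => []
  | false :: t => false :: grigAFun t
  | true :: t => true :: grigCFun t

/-- `c(0w) = 0a(w)`, `c(1w) = 1d(w)`. -/
def grigCFun : List Bool → List Bool
  | [] => []
  | false :: t => false :: grigAFun t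
  | true :: t => true :: grigDFun t

/-- `d(0w) = 0w`, `d(1w) = 1b(w)`. -/
def grigDFun : List Bool → List Bool
  | [] => []
  | false :: t => false :: t
  | true :: t => true :: grigBFun t

end

theorem grigAFun_involutive : Function.Involutive grigAFun := by
  intro t
  cases t <;> simp [grigAFun]

theorem grigBCDFun_involutive (t : List Bool) :
    grigBFun (grigBFun t) = t ∧ grigCFun (grigCFun t) = t ∧ grigDFun (grigDFun t) = t := by
  induction t with
  | nil => simp [grigBFun, grigCFun, grigDFun]
  | cons x t ih =>
    obtain ⟨hb, hc, hd⟩ := ih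
    have ha := grigAFun_involutive t
    cases x <;> simp [grigBFun, grigCFun, grigDFun, ha, hb, hc, hd]

def grigA : Equiv.Perm (List Bool) :=
  grigAFun_involutive.toPerm

def grigB : Equiv.Perm (List Bool) :=
  Function.Involutive.toPerm grigBFun (fun t => (grigBCDFun_involutive t).1)

def grigC : Equiv.Perm (List Bool) :=
  Function.Involutive.toPerm grigCFun (fun t => (grigBCDFun_involutive t).2.1)

def grigD : Equiv.Perm (List Bool) :=
  Function.Involutive.toPerm grigDFun (fun t => (grigBCDFun_involutive t).2.2)

/-- The Grigorchuk group, generated by the automorphisms `a, b, c, d` of the rooted binary tree.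
(The automorphism group of the tree is a subgroup of the group of permutations of its vertices.) -/
def grigorchukGroup : Subgroup (Equiv.Perm (List Bool)) :=
  Subgroup.closure {grigA, grigB, grigC, grigD}

/-! ## Lamplighter groups -/

/-- The shift action of `ℤ` on the finitely supported functions `ℤ → ℤ/p`:
`n` sends `f` to `m ↦ f (m - n)`. -/
def lampShift (p : ℕ) : Multiplicative ℤ →* MulAut (Multiplicative (ℤ →₀ ZMod p)) where
  toFun n := AddEquiv.toMultiplicative (Finsupp.domCongr (Equiv.addRight (Multiplicative.toAdd n)))
  map_one' := by
    refine MulEquiv.ext fun f => Multiplicative.toAdd.injective (Finsupp.ext fun m => ?_)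
    change (Multiplicative.toAdd f) (m + -(0 : ℤ)) = (Multiplicative.toAdd f) m
    simp
  map_mul' a b := by
    refine MulEquiv.ext fun f => Multiplicative.toAdd.injective (Finsupp.ext fun m => ?_)
    change (Multiplicative.toAdd f) (m + -(Multiplicative.toAdd a + Multiplicative.toAdd b)) =
      (Multiplicative.toAdd f) (m + -Multiplicative.toAdd a + -Multiplicative.toAdd b)
    congr 1
    ring

/-- The lamplighter group `(ℤ/p) ≀ ℤ`, i.e. the restricted wreath product `(⨁_ℤ ℤ/p) ⋊ ℤ`. -/
abbrev Lamplighter (p : ℕ) : Type :=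
  Multiplicative (ℤ →₀ ZMod p) ⋊[lampShift p] Multiplicative ℤ

/-! ## The allowed factors -/

/-- `G` is isomorphic to one of: a finite group; a finitely generated abelian group; a finitely
generated subgroup of a right-angled Artin group; the Grigorchuk group; the lamplighter group
`(ℤ/p) ≀ ℤ` for some `p ≥ 2`. -/
def IsListedGroup (G : Type u) [Group G] : Prop :=
  Finite G ∨
  (Group.FG G ∧ ∀ a b : G, a * b = b * a) ∨
  (∃ (V : Type v) (Γ : SimpleGraph V) (H : Subgroup (RAAG Γ)), H.FG ∧ Nonempty (G ≃* H)) ∨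
  Nonempty (G ≃* grigorchukGroup) ∨
  (∃ p : ℕ, 2 ≤ p ∧ Nonempty (G ≃* Lamplighter p))

end ActionGrowth

end
/-!
A group has a faithful action of linear growth as soon as every `g ≠ 1` moves a point in an action
graded by a height function with fibres of bounded size, along which each element of the group
climbs boundedly, the bounds being independent of `g`: put these actions side by side.

To pass to graph products the separating actions are normalised: `g` moves a point at the bottom of
the graph of the action to a point at the top. Given a geodesic word in the factors, actions that
separate its letters are then glued one above the other, the top of one to the bottom of the next,
into a single action in which the word carries the lowest point to the highest one. Letters that
commute with their neighbours are the ones that may be skipped.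

An action in which `g` climbs by a definite proportion of the total height is normalised by folding
heights with a triangle wave. This covers `ℤ` acting on long cycles, the lamplighter group acting on
a cycle of lamps read modulo `p`, and the Grigorchuk group acting on the levels of the tree, ordered
by a Gray code.
-/

noncomputable section

namespace ActionGrowth

open Equiv

/-! ### Heights and separation -/

/-- A height function with fibres of size at most `C`, for which `x` is at the bottom and `y` is at
the top. -/
structure IsHeight {X : Type*} (C : ℕ) (f : X → ℕ) (x y : X) : Prop where
  bot : f x = 0
  le_top : ∀ u, f u ≤ f y
  fiber : ∀ k, {u | f u = k}.encard ≤ C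

/-- The action `ρ` separates `g` from `1`, in the normalised form that can be glued: `g` moves the
bottom `x` of a height function to its top, and each `s` changes heights by at most `L s`. -/
structure Separates {G : Type*} [Group G] (C : ℕ) (L : G → ℕ) (g : G) {X : Type}
    (ρ : G →* Perm X) (f : X → ℕ) (x : X) : Prop where
  height : IsHeight C f x (ρ g x)
  moves : ρ g x ≠ x
  lipschitz : ∀ s u, ((f (ρ s u) : ℤ) - f u).natAbs ≤ L s

/-- Each element of `A` is separated from `1` by some action on a graded set, with the same bounds
on the size of the fibres and on the variation of heights for all of them. -/
def LinearlySeparated {G : Type*} [Group G] (C : ℕ) (A : Set G) : Prop :=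
  ∃ L : G → ℕ, ∀ g ∈ A, ∃ (X : Type) (ρ : G →* Perm X) (f : X → ℕ) (x : X), Separates C L g ρ f x

section Separation

variable {G : Type*} [Group G] {H : Type*} [Group H] {C C' : ℕ}

theorem IsHeight.mono {X : Type*} {f : X → ℕ} {x y : X} (h : IsHeight C f x y) (hC : C ≤ C') :
    IsHeight C' f x y where
  bot := h.bot
  le_top := h.le_top
  fiber k := (h.fiber k).trans (by exact_mod_cast hC)

theorem LinearlySeparated.mono {A : Set G} (h : LinearlySeparated C A) (hC : C ≤ C') :
    LinearlySeparated C' A := by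
  obtain ⟨L, hL⟩ := h
  refine ⟨L, fun g hg => ?_⟩
  obtain ⟨X, ρ, f, x, hX⟩ := hL g hg
  exact ⟨X, ρ, f, x, hX.height.mono hC, hX.moves, hX.lipschitz⟩

theorem LinearlySeparated.subset {A B : Set G} (h : LinearlySeparated C B) (hAB : A ⊆ B) :
    LinearlySeparated C A := by
  obtain ⟨L, hL⟩ := h
  exact ⟨L, fun g hg => hL g (hAB hg)⟩

theorem LinearlySeparated.comap {A : Set H} (h : LinearlySeparated C A) (φ : G →* H) :
    LinearlySeparated C (φ ⁻¹' A) := by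
  obtain ⟨L, hL⟩ := h
  refine ⟨fun g => L (φ g), fun g hg => ?_⟩
  obtain ⟨X, ρ, f, x, hX⟩ := hL _ hg
  exact ⟨X, ρ.comp φ, f, x, hX.height, hX.moves, fun s => hX.lipschitz (φ s)⟩

theorem LinearlySeparated.of_injective (h : LinearlySeparated C ({1}ᶜ : Set H)) (φ : G →* H)
    (hφ : Function.Injective φ) : LinearlySeparated C ({1}ᶜ : Set G) :=
  (h.comap φ).subset fun _ hg => (map_ne_one_iff φ hφ).2 hg

theorem LinearlySeparated.iUnion {κ : Type*} [Finite κ] {A : κ → Set G}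
    (h : ∀ k, LinearlySeparated C (A k)) : LinearlySeparated C (⋃ k, A k) := by
  choose L hL using h
  have bdd (g : G) : BddAbove (Set.range fun k => L k g) := (Set.finite_range _).bddAbove
  refine ⟨fun g => ⨆ k, L k g, fun g hg => ?_⟩
  obtain ⟨k, hk⟩ := Set.mem_iUnion.1 hg
  obtain ⟨X, ρ, f, x, hX⟩ := hL k g hk
  exact ⟨X, ρ, f, x, hX.height, hX.moves,
    fun s u => (hX.lipschitz s u).trans (le_ciSup (bdd s) k)⟩

theorem LinearlySeparated.union {A B : Set G} (hA : LinearlySeparated C A)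
    (hB : LinearlySeparated C B) : LinearlySeparated C (A ∪ B) := by
  rw [Set.union_eq_iUnion]
  exact .iUnion fun b => by cases b <;> assumption

theorem LinearlySeparated.prod (hG : LinearlySeparated C ({1}ᶜ : Set G))
    (hH : LinearlySeparated C ({1}ᶜ : Set H)) : LinearlySeparated C ({1}ᶜ : Set (G × H)) :=
  ((hG.comap (.fst G H)).union (hH.comap (.snd G H))).subset fun _ hg =>
    not_and_or.1 fun h => hg (Prod.ext h.1 h.2)

theorem LinearlySeparated.pi {κ : Type*} [Finite κ] {H : κ → Type*} [∀ k, Group (H k)]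
    (h : ∀ k, LinearlySeparated C ({1}ᶜ : Set (H k))) :
    LinearlySeparated C ({1}ᶜ : Set (∀ k, H k)) :=
  (LinearlySeparated.iUnion fun k => (h k).comap (Pi.evalMonoidHom H k)).subset fun _ hg =>
    Set.mem_iUnion.2 (Function.ne_iff.1 hg)

theorem exists_lipschitz_of_closure_eq_top {J : Type*} {t : J → G}
    (ht : Subgroup.closure (Set.range t) = ⊤) (K : J → ℕ) :
    ∃ L : G → ℕ, ∀ {X : Type} (ρ : G →* Perm X) (f : X → ℕ),
      (∀ j u, ((f (ρ (t j) u) : ℤ) - f u).natAbs ≤ K j) →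
        ∀ g u, ((f (ρ g u) : ℤ) - f u).natAbs ≤ L g := by
  suffices h : ∀ g : G, ∃ n : ℕ, ∀ (X : Type) (ρ : G →* Perm X) (f : X → ℕ),
      (∀ j u, ((f (ρ (t j) u) : ℤ) - f u).natAbs ≤ K j) →
        ∀ u, ((f (ρ g u) : ℤ) - f u).natAbs ≤ n by
    choose L hL using h
    exact ⟨L, fun ρ f hf g => hL g _ ρ f hf⟩
  intro g
  induction (ht ▸ Subgroup.mem_top g : g ∈ Subgroup.closure (Set.range t)) using
    Subgroup.closure_induction with
  | mem _ hx =>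
    obtain ⟨j, rfl⟩ := hx
    exact ⟨K j, fun _ _ _ hf => hf j⟩
  | one => exact ⟨0, by simp⟩
  | mul a b _ _ iha ihb =>
    obtain ⟨⟨m, hm⟩, n, hn⟩ := iha, ihb
    refine ⟨m + n, fun X ρ f hf u => ?_⟩
    have ha := hm X ρ f hf (ρ b u)
    have hb := hn X ρ f hf u
    rw [map_mul, Perm.mul_apply]
    omega
  | inv a _ iha =>
    obtain ⟨n, hn⟩ := iha
    refine ⟨n, fun X ρ f hf u => ?_⟩
    have ha := hn X ρ f hf (ρ a⁻¹ u)
    rw [← Perm.mul_apply, ← map_mul, mul_inv_cancel, map_one, Perm.one_apply] at ha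
    omega

end Separation

/-! ### Separation implies linear growth -/

section LinearGrowth

theorem growthLE_id_of_le_mul {f : ℕ → ℕ} {K : ℕ} (h : ∀ n, 1 ≤ n → f n ≤ K * n) :
    GrowthLE f fun n => n := by
  refine ⟨K + 1, K.succ_pos, fun n hn => (h n hn).trans ?_⟩
  gcongr
  · exact K.le_succ
  · exact Nat.le_mul_of_pos_left n K.succ_pos

theorem encard_preimage_finset_le {X Y : Type*} {f : X → Y} {C : ℕ}
    (hf : ∀ k, {u | f u = k}.encard ≤ C) (s : Finset Y) :
    (f ⁻¹' s).encard ≤ (s.card * C : ℕ) := by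
  have hcover : f ⁻¹' s = ⋃ k ∈ s, {u | f u = k} := by ext; simp
  calc (f ⁻¹' s).encard ≤ ∑ k ∈ s, {u | f u = k}.encard :=
        hcover ▸ s.set_encard_biUnion_le _
    _ ≤ ∑ _k ∈ s, (C : ℕ∞) := Finset.sum_le_sum fun k _ => hf k
    _ = (s.card * C : ℕ) := by simp

variable {G : Type u} [Group G] {C : ℕ} {L : G → ℕ} {g : G} {X : Type} {ρ : G →* Perm X}
  {f : X → ℕ} {x : X} {S : Set G}

theorem Separates.natAbs_sub_le_of_mem_wordBall (h : Separates C L g ρ f x) {M : ℕ}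
    (hM : ∀ s ∈ S, L s ≤ M) {n : ℕ} {w : G} (hw : w ∈ wordBall S n) (u : X) :
    ((f (ρ w u) : ℤ) - f u).natAbs ≤ n * M := by
  obtain ⟨l, hl, hlS, rfl⟩ := hw
  refine le_trans ?_ (Nat.mul_le_mul_right M hl)
  clear hl
  induction l with
  | nil => simp
  | cons s l ih =>
    rw [List.forall_mem_cons] at hlS
    have hs := (h.lipschitz s (ρ l.prod u)).trans (hM s hlS.1)
    have hl := ih hlS.2
    rw [List.prod_cons, map_mul, Perm.mul_apply, List.length_cons, add_one_mul]
    omega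

theorem Separates.encard_wordBall_le (h : Separates C L g ρ f x) {M : ℕ}
    (hM : ∀ s ∈ S, L s ≤ M) (n : ℕ) (u : X) :
    ((fun w => ρ w u) '' wordBall S n).encard ≤ ((2 * (n * M) + 1) * C : ℕ) := by
  have hsub : (fun w => ρ w u) '' wordBall S n ⊆
      f ⁻¹' (Finset.Icc (f u - n * M) (f u + n * M) : Finset ℕ) := by
    rintro _ ⟨w, hw, rfl⟩
    have := h.natAbs_sub_le_of_mem_wordBall hM hw u
    simp only [Set.mem_preimage, Finset.coe_Icc, Set.mem_Icc]
    omega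
  refine (Set.encard_le_encard hsub).trans
    ((encard_preimage_finset_le h.height.fiber _).trans (Nat.cast_le.2 ?_))
  gcongr
  rw [Nat.card_Icc]
  omega

theorem LinearlySeparated.classCLin (h : LinearlySeparated C ({1}ᶜ : Set G)) (hG : Group.FG G) :
    ClassCLin G := by
  obtain ⟨L, hL⟩ := h
  choose X ρ f x hX using fun g : ({1}ᶜ : Set G) => hL g g.2
  let (g : ({1}ᶜ : Set G)) : MulAction G (X g) := .compHom _ (ρ g)
  refine ⟨hG, Σ g, X g, inferInstance, faithfulSMul_iff.2 fun g hg => ?_, fun S hS => ?_⟩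
  · by_contra h1
    exact (hX ⟨g, h1⟩).moves (sigma_mk_injective (hg ⟨⟨g, h1⟩, x ⟨g, h1⟩⟩))
  · obtain ⟨M, hM⟩ := (hS.finite.image L).bddAbove
    replace hM : ∀ s ∈ S, L s ≤ M := fun s hs => hM (Set.mem_image_of_mem L hs)
    refine growthLE_id_of_le_mul (K := (2 * M + 1) * C) fun n hn => ciSup_le' fun ⟨g, u⟩ => ?_
    have himage : (fun w : G => w • (⟨g, u⟩ : Σ g, X g)) '' wordBall S n =
        Sigma.mk g '' ((fun w => ρ g w u) '' wordBall S n) := by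
      rw [Set.image_image]; rfl
    rw [himage, Set.ncard_image_of_injective _ sigma_mk_injective]
    calc _ ≤ (2 * (n * M) + 1) * C :=
          ENat.toNat_le_of_le_natCast ((hX g).encard_wordBall_le hM n u)
      _ ≤ (2 * (n * M) + n) * C := by gcongr
      _ = (2 * M + 1) * C * n := by ring

end LinearGrowth

/-! ### Folding heights -/

section Folding

theorem natAbs_valMinAbs_intCast_le (n : ℕ) [NeZero n] (e : ℤ) :
    (e : ZMod n).valMinAbs.natAbs ≤ e.natAbs :=
  ZMod.natAbs_min_of_le_div_two n _ _ (ZMod.coe_valMinAbs _) (ZMod.natAbs_valMinAbs_le _)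

theorem natAbs_valMinAbs_add_intCast_sub_le {n : ℕ} [NeZero n] (a : ZMod n) (e : ℤ) :
    (((a + e).valMinAbs.natAbs : ℤ) - a.valMinAbs.natAbs).natAbs ≤ e.natAbs := by
  have le (b : ZMod n) (e : ℤ) : (b + e).valMinAbs.natAbs ≤ b.valMinAbs.natAbs + e.natAbs :=
    (ZMod.natAbs_valMinAbs_add_le b e).trans ((Int.natAbs_add_le _ _).trans
      (Nat.add_le_add_left (natAbs_valMinAbs_intCast_le n e) _))
  have h₁ := le a e
  have h₂ := le (a + e) (-e)
  rw [Int.cast_neg, add_neg_cancel_right] at h₂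
  omega

theorem eq_or_eq_neg_of_natAbs_valMinAbs_eq {n k : ℕ} {a : ZMod n}
    (h : a.valMinAbs.natAbs = k) : a = k ∨ a = -k := by
  have := (ZMod.coe_valMinAbs a).symm
  rcases Int.natAbs_eq_iff.1 h with h | h <;> rw [h] at this
  · exact .inl (by exact_mod_cast this)
  · exact .inr (by rw [this, Int.cast_neg, Int.cast_natCast])

theorem encard_natAbs_valMinAbs_eq_le_two (n k : ℕ) :
    {a : ZMod n | a.valMinAbs.natAbs = k}.encard ≤ 2 :=
  calc {a : ZMod n | a.valMinAbs.natAbs = k}.encard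
      ≤ ({(k : ZMod n), -(k : ZMod n)} : Set _).encard :=
        Set.encard_le_encard fun _ => eq_or_eq_neg_of_natAbs_valMinAbs_eq
    _ ≤ ({-(k : ZMod n)} : Set _).encard + 1 := Set.encard_insert_le _ _
    _ = 2 := by rw [Set.encard_singleton, one_add_one_eq_two]

/-- The `2D`-periodic triangle wave `ℤ → {0, …, D}`: the distance to the multiples of `2D`. -/
def triangleWave (D : ℕ) (t : ℤ) : ℕ :=
  (t : ZMod (2 * D)).valMinAbs.natAbs

theorem triangleWave_zero (D : ℕ) : triangleWave D 0 = 0 := by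
  simp [triangleWave]

theorem triangleWave_of_natAbs_eq {D : ℕ} {t : ℤ} (ht : t.natAbs = D) : triangleWave D t = D := by
  rcases Int.natAbs_eq_iff.1 ht with rfl | rfl
  · rw [triangleWave, Int.cast_natCast, ZMod.valMinAbs_natCast_of_le_half (by omega),
      Int.natAbs_natCast]
  · rw [triangleWave, Int.cast_neg, Int.cast_natCast, ZMod.natAbs_valMinAbs_neg,
      ZMod.valMinAbs_natCast_of_le_half (by omega), Int.natAbs_natCast]

theorem exists_eq_of_triangleWave_eq {D : ℕ} {t : ℤ} {k : ℕ} (hk : triangleWave D t = k) :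
    ∃ q : ℤ, t = 2 * D * q + k ∨ t = 2 * D * q - k := by
  rcases eq_or_eq_neg_of_natAbs_valMinAbs_eq hk with h | h
  · rw [← Int.cast_natCast, eq_comm, ZMod.intCast_eq_intCast_iff_dvd_sub] at h
    obtain ⟨q, hq⟩ := h
    exact ⟨q, .inl (by push_cast at hq; linarith)⟩
  · rw [← Int.cast_natCast, ← Int.cast_neg, eq_comm, ZMod.intCast_eq_intCast_iff_dvd_sub] at h
    obtain ⟨q, hq⟩ := h
    exact ⟨q, .inr (by push_cast at hq; linarith)⟩

variable {D : ℕ} [NeZero D]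

theorem triangleWave_le (t : ℤ) : triangleWave D t ≤ D := by
  have := ZMod.natAbs_valMinAbs_le (t : ZMod (2 * D))
  rw [triangleWave]
  omega

theorem natAbs_triangleWave_sub_le (s t : ℤ) :
    ((triangleWave D s : ℤ) - triangleWave D t).natAbs ≤ (s - t).natAbs := by
  have := natAbs_valMinAbs_add_intCast_sub_le (t : ZMod (2 * D)) (s - t)
  rwa [← Int.cast_add, add_sub_cancel] at this

/-- The triangle wave takes each value at most twice per period. -/
theorem encard_triangleWave_eq_le {X : Type*} {h : X → ℤ} {C M : ℕ}
    (hfiber : ∀ c, {u | h u = c}.encard ≤ C) (hM : ∀ u, (h u).natAbs ≤ M * D) (k : ℕ) :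
    {u | triangleWave D (h u) = k}.encard ≤ (2 * (2 * M + 1) * C : ℕ) := by
  classical
  let I := Finset.Icc (-M : ℤ) M
  let s := I.image (fun q : ℤ => 2 * D * q + k) ∪ I.image (fun q : ℤ => 2 * D * q - k)
  have hsub : {u | triangleWave D (h u) = k} ⊆ h ⁻¹' s := by
    rintro u (hu : triangleWave D (h u) = k)
    have hk : k ≤ D := hu ▸ triangleWave_le _
    obtain ⟨q, hq⟩ := exists_eq_of_triangleWave_eq hu
    have hqI : q ∈ I := by
      have hM := hM u
      have hle : (2 * D * q).natAbs ≤ M * D + D := by omega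
      have hlt : 2 * D * q.natAbs < 2 * D * (M + 1) := by
        rw [Int.natAbs_mul, Int.natAbs_mul, Int.natAbs_natCast,
          show Int.natAbs 2 = 2 from rfl] at hle
        nlinarith [NeZero.pos D]
      have := lt_of_mul_lt_mul_left' hlt
      rw [Finset.mem_Icc]
      omega
    simp only [s, Set.mem_preimage, Finset.coe_union, Finset.coe_image]
    rcases hq with hq | hq
    · exact .inl ⟨q, hqI, hq.symm⟩
    · exact .inr ⟨q, hqI, hq.symm⟩
  refine (Set.encard_le_encard hsub).trans
    ((encard_preimage_finset_le hfiber _).trans (Nat.cast_le.2 (Nat.mul_le_mul_right C ?_)))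
  have hI : I.card = 2 * M + 1 := by rw [Int.card_Icc]; omega
  calc s.card ≤ I.card + I.card :=
        (Finset.card_union_le _ _).trans (add_le_add Finset.card_image_le Finset.card_image_le)
    _ = 2 * (2 * M + 1) := by rw [hI, ← two_mul]

theorem LinearlySeparated.of_displacement {G : Type*} [Group G] {A T : Set G}
    (hT : Subgroup.closure T = ⊤) {C K M : ℕ}
    (h : ∀ g ∈ A, ∃ (X : Type) (ρ : G →* Perm X) (h : X → ℤ) (x : X),
      h (ρ g x) ≠ h x ∧ (∀ u v, (h u - h v).natAbs ≤ M * (h (ρ g x) - h x).natAbs) ∧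
      (∀ s ∈ T, ∀ u, (h (ρ s u) - h u).natAbs ≤ K) ∧ ∀ c, {u | h u = c}.encard ≤ C) :
    LinearlySeparated (2 * (2 * M + 1) * C) A := by
  obtain ⟨L, hL⟩ := exists_lipschitz_of_closure_eq_top (t := ((↑) : T → G))
    (by rwa [Subtype.range_coe]) fun _ => K
  refine ⟨L, fun g hg => ?_⟩
  obtain ⟨X, ρ, h, x, hne, hspread, hlip, hfiber⟩ := h g hg
  set D := (h (ρ g x) - h x).natAbs with hD
  have : NeZero D := ⟨by rwa [hD, Int.natAbs_ne_zero, sub_ne_zero]⟩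
  have hbot : triangleWave D (h x - h x) = 0 := by rw [sub_self, triangleWave_zero]
  have htop : triangleWave D (h (ρ g x) - h x) = D := triangleWave_of_natAbs_eq rfl
  refine ⟨X, ρ, fun u => triangleWave D (h u - h x), x, ⟨hbot, fun u => ?_, ?_⟩, fun hx => ?_,
    hL ρ (fun u => triangleWave D (h u - h x)) fun s u => ?_⟩
  · exact (triangleWave_le _).trans_eq htop.symm
  · refine encard_triangleWave_eq_le (fun c => ?_) fun u => hspread u x
    simpa only [sub_eq_iff_eq_add] using hfiber (c + h x)
  · exact hne (congrArg h hx)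
  · refine (natAbs_triangleWave_sub_le _ _).trans ?_
    rw [sub_sub_sub_cancel_right]
    exact hlip s s.2 u

end Folding

/-! ### Finite groups and abelian groups -/

section Abelian

theorem linearlySeparated_of_finite (G : Type*) [Group G] [Finite G] :
    LinearlySeparated (Nat.card G) ({1}ᶜ : Set G) := by
  let e := Finite.equivFin G
  refine ⟨0, fun g hg => ⟨Fin (Nat.card G),
    e.permCongrHom.toMonoidHom.comp (MulAction.toPermHom G G), 0, e 1,
    ⟨rfl, fun _ => le_rfl, fun _ => Set.encard_le_card.trans (by simp)⟩, ?_, fun _ _ => le_rfl⟩⟩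
  simpa [Equiv.permCongrHom] using hg

/-- The action of `ℤ` on `ℤ/n` by rotations. -/
def rotation (n : ℕ) : Multiplicative ℤ →* Perm (ZMod n) :=
  zpowersHom _ (Equiv.addRight 1)

theorem rotation_apply (n : ℕ) (k : Multiplicative ℤ) (a : ZMod n) :
    rotation n k a = a + (k.toAdd : ℤ) := by
  simp [rotation]

theorem linearlySeparated_int : LinearlySeparated 2 ({1}ᶜ : Set (Multiplicative ℤ)) := by
  refine ⟨fun k => k.toAdd.natAbs, fun g hg => ?_⟩
  set D := g.toAdd.natAbs with hD
  have : NeZero D := ⟨Int.natAbs_ne_zero.2 hg⟩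
  have htop : (rotation (2 * D) g 0).valMinAbs.natAbs = D := by
    rw [rotation_apply, zero_add]
    exact triangleWave_of_natAbs_eq hD.symm
  refine ⟨ZMod (2 * D), rotation _, fun a => a.valMinAbs.natAbs, 0,
    ⟨by simp, fun a => ?_, encard_natAbs_valMinAbs_eq_le_two _⟩, fun h0 => ?_, fun s a => ?_⟩
  · have := ZMod.natAbs_valMinAbs_le a
    simp only [htop]
    omega
  · rw [h0, ZMod.valMinAbs_zero] at htop
    exact NeZero.ne D htop.symm
  · rw [rotation_apply]
    exact natAbs_valMinAbs_add_intCast_sub_le a _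

theorem exists_linearlySeparated_of_comm (G : Type*) [Group G] [Group.FG G]
    (hcomm : ∀ a b : G, a * b = b * a) : ∃ C, LinearlySeparated C ({1}ᶜ : Set G) := by
  let : CommGroup G := { ‹Group G› with mul_comm := hcomm }
  obtain ⟨κ, j, _, _, p, hp, e, ⟨φ⟩⟩ := CommGroup.equiv_free_prod_prod_multiplicative_zmod G
  have (k : κ) : NeZero (p k ^ e k) := ⟨pow_ne_zero _ (hp k).ne_zero⟩
  have (k : κ) : Finite (Multiplicative (ZMod (p k ^ e k))) :=
    inferInstanceAs (Finite (ZMod (p k ^ e k)))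
  exact ⟨_, (((LinearlySeparated.pi fun _ => linearlySeparated_int).mono (le_max_left _ _)).prod
    ((linearlySeparated_of_finite _).mono (le_max_right _ _))).of_injective
      φ.toMonoidHom φ.injective⟩

end Abelian

/-! ### Words in graph products -/

section GraphProduct

variable {ι : Type w} {Γ : SimpleGraph ι} {G : ι → Type u} [∀ i, Group (G i)]

/-- The canonical map from a vertex group to the graph product. -/
def ofVertex (Γ : SimpleGraph ι) (i : ι) : G i →* GraphProduct Γ G :=
  (QuotientGroup.mk' _).comp Monoid.CoprodI.of

theorem ofVertex_commute {i j : ι} (hij : Γ.Adj i j) (g : G i) (h : G j) :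
    Commute (ofVertex Γ i g) (ofVertex Γ j h) := by
  have hrel : ofVertex Γ i g * ofVertex Γ j h * (ofVertex Γ i g)⁻¹ * (ofVertex Γ j h)⁻¹ = 1 :=
    (QuotientGroup.eq_one_iff _).2 (Subgroup.subset_normalClosure ⟨i, j, hij, g, h, rfl⟩)
  exact mul_inv_eq_iff_eq_mul.1 (mul_inv_eq_one.1 hrel)

/-- The universal property of the graph product. -/
def liftVertex {H : Type*} [Group H] (φ : ∀ i, G i →* H)
    (hφ : ∀ i j, Γ.Adj i j → ∀ g h, Commute (φ i g) (φ j h)) : GraphProduct Γ G →* H :=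
  QuotientGroup.lift _ (Monoid.CoprodI.lift φ) <| Subgroup.normalClosure_le_normal <| by
    rintro _ ⟨i, j, hij, g, h, rfl⟩
    simp only [SetLike.mem_coe, MonoidHom.mem_ker, map_mul, map_inv, Monoid.CoprodI.lift_of]
    rw [(hφ i j hij g h).eq, mul_inv_cancel_right, mul_inv_cancel]

theorem liftVertex_ofVertex {H : Type*} [Group H] (φ : ∀ i, G i →* H)
    (hφ : ∀ i j, Γ.Adj i j → ∀ g h, Commute (φ i g) (φ j h)) (i : ι) (g : G i) :
    liftVertex φ hφ (ofVertex Γ i g) = φ i g :=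
  Monoid.CoprodI.lift_of φ g

open Classical in
/-- The retraction of the graph product onto a vertex group. -/
def toVertex (Γ : SimpleGraph ι) (i : ι) : GraphProduct Γ G →* G i :=
  liftVertex (Pi.mulSingle (M := fun j => G j →* G i) i (.id _)) fun j k hjk g h => by
    by_cases hj : j = i
    · subst hj
      simp [Pi.mulSingle_eq_of_ne hjk.ne']
    · simp [Pi.mulSingle_eq_of_ne hj]

theorem toVertex_ofVertex_self (i : ι) (g : G i) : toVertex Γ i (ofVertex Γ i g) = g := by
  classical
  rw [toVertex, liftVertex_ofVertex, Pi.mulSingle_eq_same, MonoidHom.id_apply]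

theorem toVertex_ofVertex_of_ne {i j : ι} (hij : j ≠ i) (g : G j) :
    toVertex Γ i (ofVertex Γ j g) = 1 := by
  classical
  rw [toVertex, liftVertex_ofVertex, Pi.mulSingle_eq_of_ne hij, MonoidHom.one_apply]

/-- The element of the graph product represented by a word in the elements of the vertex groups. -/
def wordProd (Γ : SimpleGraph ι) (l : List (Σ i, G i)) : GraphProduct Γ G :=
  (l.map fun s => ofVertex Γ s.1 s.2).prod

@[simp]
theorem wordProd_nil : wordProd Γ ([] : List (Σ i, G i)) = 1 := rfl

@[simp]
theorem wordProd_cons (s : Σ i, G i) (l : List (Σ i, G i)) :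
    wordProd Γ (s :: l) = ofVertex Γ s.1 s.2 * wordProd Γ l := by
  simp [wordProd]

@[simp]
theorem wordProd_append (l l' : List (Σ i, G i)) :
    wordProd Γ (l ++ l') = wordProd Γ l * wordProd Γ l' := by
  simp [wordProd]

theorem wordProd_surjective : Function.Surjective (wordProd Γ : List (Σ i, G i) → _) := by
  intro w
  obtain ⟨w, rfl⟩ := QuotientGroup.mk'_surjective _ w
  induction w using Monoid.CoprodI.induction_on with
  | one => exact ⟨[], (map_one _).symm⟩
  | of i g => exact ⟨[⟨i, g⟩], by rw [wordProd_cons, wordProd_nil, mul_one]; rfl⟩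
  | mul x y hx hy =>
    obtain ⟨⟨l, hl⟩, l', hl'⟩ := hx, hy
    exact ⟨l ++ l', by rw [wordProd_append, hl, hl', map_mul]⟩

theorem closure_range_ofVertex :
    Subgroup.closure (Set.range fun s : Σ i, G i => ofVertex Γ s.1 s.2) = ⊤ := by
  refine (Subgroup.eq_top_iff' _).2 fun w => ?_
  obtain ⟨l, rfl⟩ := wordProd_surjective w
  refine Subgroup.list_prod_mem _ fun x hx => ?_
  obtain ⟨s, _, rfl⟩ := List.mem_map.1 hx
  exact Subgroup.subset_closure ⟨s, rfl⟩

theorem fg_graphProduct [Finite ι] (Γ : SimpleGraph ι) (hG : ∀ i, Group.FG (G i)) :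
    Group.FG (GraphProduct Γ G) := by
  choose S hS hfin using fun i => Group.fg_iff.1 (hG i)
  refine Group.fg_iff.2 ⟨⋃ i, ofVertex Γ i '' S i, ?_, Set.finite_iUnion fun i => (hfin i).image _⟩
  rw [eq_top_iff, ← closure_range_ofVertex, Subgroup.closure_le]
  rintro _ ⟨⟨i, g⟩, rfl⟩
  have hg : ofVertex Γ i g ∈ (Subgroup.closure (S i)).map (ofVertex Γ i) :=
    Subgroup.mem_map_of_mem _ (hS i ▸ Subgroup.mem_top g)
  rw [MonoidHom.map_closure] at hg
  exact Subgroup.closure_mono (Set.subset_iUnion (fun i => ofVertex Γ i '' S i) i) hg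

theorem normalClosure_graphProductRels_bot (G : ι → Type u) [∀ i, Group (G i)] :
    Subgroup.normalClosure (graphProductRels (⊥ : SimpleGraph ι) G) = ⊥ := by
  have : graphProductRels (⊥ : SimpleGraph ι) G = ∅ := by
    ext x; simp [graphProductRels]
  rw [this, Subgroup.normalClosure_empty]

/-- The free product is the graph product along the graph without edges. -/
def coprodEquivGraphProduct (G : ι → Type u) [∀ i, Group (G i)] :
    Monoid.CoprodI G ≃* GraphProduct (⊥ : SimpleGraph ι) G :=
  ((QuotientGroup.quotientMulEquivOfEq (normalClosure_graphProductRels_bot G)).trans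
    QuotientGroup.quotientBot).symm

/-- A word of minimal length among those representing the same element. -/
def IsGeodesicWord (Γ : SimpleGraph ι) (l : List (Σ i, G i)) : Prop :=
  ∀ l', wordProd Γ l' = wordProd Γ l → l.length ≤ l'.length

theorem exists_isGeodesicWord (w : GraphProduct Γ G) :
    ∃ l, wordProd Γ l = w ∧ IsGeodesicWord Γ l := by
  obtain ⟨l, rfl, hmin⟩ := exists_minimalFor_of_wellFoundedLT
    (fun l => wordProd Γ l = w) List.length (wordProd_surjective w)
  exact ⟨l, rfl, fun l' hl' => (le_total _ _).elim id (hmin hl')⟩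

theorem IsGeodesicWord.tail {s : Σ i, G i} {l : List (Σ i, G i)}
    (h : IsGeodesicWord Γ (s :: l)) : IsGeodesicWord Γ l := fun l' hl' => by
  simpa using h (s :: l') (by simp [hl'])

theorem IsGeodesicWord.ne_one {s : Σ i, G i} {l : List (Σ i, G i)}
    (h : IsGeodesicWord Γ (s :: l)) : s.2 ≠ 1 := fun hs => by
  simpa using h l (by simp [hs])

theorem ofVertex_commute_wordProd {i : ι} (g : G i) {l : List (Σ i, G i)}
    (hl : ∀ s ∈ l, Γ.Adj s.1 i) : Commute (ofVertex Γ i g) (wordProd Γ l) := by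
  refine Commute.list_prod_right _ _ fun x hx => ?_
  obtain ⟨s, hs, rfl⟩ := List.mem_map.1 hx
  exact ofVertex_commute (hl s hs).symm _ _

/-- Otherwise the two letters could be merged. -/
theorem IsGeodesicWord.ne_of_adj {t s : Σ i, G i} {l l' : List (Σ i, G i)}
    (hw : IsGeodesicWord Γ (t :: (l ++ s :: l'))) (hl : ∀ r ∈ l, Γ.Adj r.1 s.1) : t.1 ≠ s.1 := by
  obtain ⟨⟨i, g⟩, j, h⟩ := t, s
  rintro rfl
  have := hw (l ++ ⟨i, g * h⟩ :: l') (by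
    simp only [wordProd_cons, wordProd_append, map_mul, ← mul_assoc,
      (ofVertex_commute_wordProd g hl).eq])
  simp at this

end GraphProduct

/-! ### Wedges of actions -/

section Wedge

variable {X Y : Type} {y : Y} {z : X}

/-- The wedge of `Y` and `X` along the base points `y` and `z`: the disjoint union in which `z` is
left out, its role being played by `y`. -/
abbrev Wedge (Y : Type) {X : Type} (z : X) : Type :=
  Y ⊕ {u : X // u ≠ z}

open Classical in
/-- The embedding of `X` in the wedge, which sends `z` to `y`. -/
def wedgeInr (y : Y) (z : X) : X ↪ Wedge Y z where
  toFun u := if h : u = z then .inl y else .inr ⟨u, h⟩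
  inj' u v huv := by
    by_cases hu : u = z <;> by_cases hv : v = z <;> simp_all

theorem wedgeInr_self (y : Y) (z : X) : wedgeInr y z z = .inl y :=
  dif_pos rfl

theorem wedgeInr_of_ne (y : Y) {u z : X} (h : u ≠ z) : wedgeInr y z u = .inr ⟨u, h⟩ :=
  dif_neg h

theorem inl_notMem_range_wedgeInr {u : Y} (h : u ≠ y) :
    (.inl u : Wedge Y z) ∉ Set.range (wedgeInr y z) := by
  rintro ⟨v, hv⟩
  by_cases hvz : v = z
  · rw [hvz, wedgeInr_self] at hv
    exact h (Sum.inl_injective hv).symm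
  · simp [wedgeInr_of_ne y hvz] at hv

/-- The permutation `q` of the second summand followed by the permutation `p` of the first one,
both extended by the identity. -/
def wedgePerm (y : Y) (z : X) (p : Perm Y) (q : Perm X) : Perm (Wedge Y z) :=
  p.viaEmbedding .inl * q.viaEmbedding (wedgeInr y z)

theorem wedgePerm_inl {p : Perm Y} {q : Perm X} {u : Y} (h : u = y → q z = z) :
    wedgePerm y z p q (.inl u) = .inl (p u) := by
  have hq : q.viaEmbedding (wedgeInr y z) (.inl u) = .inl u := by
    by_cases hu : u = y
    · rw [hu, ← wedgeInr_self y z, Perm.viaEmbedding_apply, h hu]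
    · exact Perm.viaEmbedding_apply_of_notMem _ _ _ (inl_notMem_range_wedgeInr hu)
  rw [wedgePerm, Perm.mul_apply, hq]
  exact p.viaEmbedding_apply .inl u

theorem wedgePerm_wedgeInr {p : Perm Y} {q : Perm X} {v : X} (h : q v = z → p y = y) :
    wedgePerm y z p q (wedgeInr y z v) = wedgeInr y z (q v) := by
  rw [wedgePerm, Perm.mul_apply, Perm.viaEmbedding_apply]
  by_cases hv : q v = z
  · rw [hv, wedgeInr_self]
    exact (p.viaEmbedding_apply .inl y).trans (congrArg _ (h hv))
  · rw [wedgeInr_of_ne y hv]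
    exact Perm.viaEmbedding_apply_of_notMem _ _ _ (by simp)

theorem disjoint_viaEmbedding_wedge {p : Perm Y} {q : Perm X} (h : p y = y ∨ q z = z) :
    (p.viaEmbedding (.inl : Y ↪ Wedge Y z)).Disjoint (q.viaEmbedding (wedgeInr y z)) := by
  rintro (u | v)
  · by_cases hu : u = y
    · rw [hu]
      refine h.imp (fun hp => ?_) fun hq => ?_
      · exact (p.viaEmbedding_apply .inl y).trans (congrArg _ hp)
      · rw [← wedgeInr_self y z, Perm.viaEmbedding_apply, hq]
    · exact .inr (Perm.viaEmbedding_apply_of_notMem _ _ _ (inl_notMem_range_wedgeInr hu))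
  · exact .inl (Perm.viaEmbedding_apply_of_notMem _ _ _ (by simp))

theorem wedgePerm_mul {p p' : Perm Y} {q q' : Perm X} (h : p' y = y ∨ q z = z) :
    wedgePerm y z (p * p') (q * q') = wedgePerm y z p q * wedgePerm y z p' q' := by
  have hp : (p * p').viaEmbedding (.inl : Y ↪ Wedge Y z) = _ :=
    map_mul (Perm.viaEmbeddingHom _) p p'
  have hq : (q * q').viaEmbedding (wedgeInr y z) = _ := map_mul (Perm.viaEmbeddingHom _) q q'
  rw [wedgePerm, hp, hq]
  exact (disjoint_viaEmbedding_wedge h).commute.mul_mul_mul_comm _ _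

theorem wedgePerm_commute {p p' : Perm Y} {q q' : Perm X} (hp : Commute p p') (hq : Commute q q')
    (h : p y = y ∨ q' z = z) (h' : p' y = y ∨ q z = z) :
    Commute (wedgePerm y z p q) (wedgePerm y z p' q') := by
  rw [commute_iff_eq, ← wedgePerm_mul h', ← wedgePerm_mul h, hp.eq, hq.eq]

theorem wedgePerm_apply_cases {p : Perm Y} {q : Perm X} (h : p y = y ∨ q z = z) (w : Wedge Y z) :
    (∃ u, w = .inl u ∧ wedgePerm y z p q w = .inl (p u)) ∨
      ∃ v, w = wedgeInr y z v ∧ wedgePerm y z p q w = wedgeInr y z (q v) := by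
  obtain u | ⟨v, hv⟩ := w
  · by_cases hu : u = y → q z = z
    · exact .inl ⟨u, rfl, wedgePerm_inl hu⟩
    · obtain ⟨rfl, hq⟩ := Classical.not_imp.1 hu
      rw [← wedgeInr_self u z]
      exact .inr ⟨z, rfl, wedgePerm_wedgeInr fun _ => h.resolve_right hq⟩
  · rw [← wedgeInr_of_ne y hv]
    refine .inr ⟨v, rfl, wedgePerm_wedgeInr fun hqv => h.resolve_right fun hqz => ?_⟩
    exact hv (q.injective (hqv.trans hqz.symm))

/-- Heights on the wedge, the second summand being placed above the point `y`. The shift by `1`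
keeps the fibres of `f` and `e` apart when `y` is at the top of `Y`. -/
def wedgeHeight (f : Y → ℕ) (y : Y) (e : X → ℕ) : Wedge Y z → ℕ :=
  Sum.elim f fun u => f y + 1 + e u

theorem wedgeHeight_wedgeInr_mem_Icc (f : Y → ℕ) {e : X → ℕ} (hz : e z = 0) (v : X) :
    wedgeHeight f y e (wedgeInr y z v) ∈ Set.Icc (f y + e v) (f y + e v + 1) := by
  by_cases hv : v = z
  · simp [hv, wedgeInr_self, wedgeHeight, hz]
  · simp only [wedgeInr_of_ne y hv, wedgeHeight, Sum.elim_inr, Set.mem_Icc]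
    omega

theorem natAbs_wedgeHeight_sub_le {f : Y → ℕ} {e : X → ℕ} {K : ℕ} {p : Perm Y} {q : Perm X}
    (h : p y = y ∨ q z = z) (hz : e z = 0) (hf : ∀ u, ((f (p u) : ℤ) - f u).natAbs ≤ K + 1)
    (he : ∀ v, ((e (q v) : ℤ) - e v).natAbs ≤ K) (w : Wedge Y z) :
    ((wedgeHeight f y e (wedgePerm y z p q w) : ℤ) - wedgeHeight f y e w).natAbs ≤ K + 1 := by
  obtain ⟨u, rfl, hw⟩ | ⟨v, rfl, hw⟩ := wedgePerm_apply_cases h w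
  · rw [hw]
    exact hf u
  · have h₁ := wedgeHeight_wedgeInr_mem_Icc (y := y) f hz v
    have h₂ := wedgeHeight_wedgeInr_mem_Icc (y := y) f hz (q v)
    have := he v
    rw [Set.mem_Icc] at h₁ h₂
    rw [hw]
    omega

theorem IsHeight.wedge {C : ℕ} {f : Y → ℕ} {x : Y} (hf : IsHeight C f x y) {e : X → ℕ} {v : X}
    (he : IsHeight C e z v) (hv : v ≠ z) :
    IsHeight C (wedgeHeight f y e : Wedge Y z → ℕ) (.inl x) (wedgeInr y z v) where
  bot := hf.bot
  le_top w := by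
    rw [wedgeInr_of_ne y hv]
    obtain u | u := w
    · exact (hf.le_top u).trans (by simp only [wedgeHeight, Sum.elim_inr]; omega)
    · exact Nat.add_le_add_left (he.le_top u) _
  fiber k := by
    by_cases hk : k ≤ f y
    · have hsub : {w : Wedge Y z | wedgeHeight f y e w = k} ⊆ Sum.inl '' {u | f u = k} := by
        rintro (u | u) hu
        · exact ⟨u, hu, rfl⟩
        · have : f y + 1 + e u = k := hu
          omega
      exact (Set.encard_le_encard hsub).trans ((Set.encard_image_le _ _).trans (hf.fiber k))
    · have hsub : {w : Wedge Y z | wedgeHeight f y e w = k} ⊆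
          wedgeInr y z '' {v | e v = k - (f y + 1)} := by
        rintro (u | u) hu
        · exact absurd ((show f u = k from hu) ▸ hf.le_top u) hk
        · have : f y + 1 + e u = k := hu
          exact ⟨u, by rw [Set.mem_ofPred_eq]; omega, wedgeInr_of_ne y u.2⟩
      exact (Set.encard_le_encard hsub).trans ((Set.encard_image_le _ _).trans (he.fiber _))

variable {ι : Type w} {Γ : SimpleGraph ι} {G : ι → Type u} [∀ i, Group (G i)]

/-- The action on a wedge that restricts to the given ones on both summands, away from the base
point. -/
def wedgeAction (ρ : GraphProduct Γ G →* Perm Y) (κ : GraphProduct Γ G →* Perm X) (y : Y) (z : X)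
    (h : ∀ i j, i = j ∨ Γ.Adj i j → ∀ a b,
      ρ (ofVertex Γ i a) y = y ∨ κ (ofVertex Γ j b) z = z) :
    GraphProduct Γ G →* Perm (Wedge Y z) :=
  liftVertex
    (fun i => .mk' (fun a => wedgePerm y z (ρ (ofVertex Γ i a)) (κ (ofVertex Γ i a)))
      fun a b => by simp only [map_mul, wedgePerm_mul (h i i (.inl rfl) b a)])
    fun i j hij a b =>
      wedgePerm_commute ((ofVertex_commute hij a b).map ρ) ((ofVertex_commute hij a b).map κ)
        (h i j (.inr hij) a b) (h j i (.inr hij.symm) b a)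

theorem wedgeAction_ofVertex (ρ : GraphProduct Γ G →* Perm Y) (κ : GraphProduct Γ G →* Perm X)
    (h : ∀ i j, i = j ∨ Γ.Adj i j → ∀ a b,
      ρ (ofVertex Γ i a) y = y ∨ κ (ofVertex Γ j b) z = z) (i : ι) (a : G i) :
    wedgeAction ρ κ y z h (ofVertex Γ i a) =
      wedgePerm y z (ρ (ofVertex Γ i a)) (κ (ofVertex Γ i a)) :=
  liftVertex_ofVertex ..

end Wedge

/-! ### Chains of actions -/

section Chain

variable {ι : Type w} {Γ : SimpleGraph ι} {G : ι → Type u} [∀ i, Group (G i)] {C : ℕ}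
  {L : ∀ i, G i → ℕ} {s t : Σ i, G i} {l : List (Σ i, G i)} {X Y : Type}

/-- An action of the graph product in which the word `s :: l` climbs from the bottom `x` to the top
`y`, the top being reached with the last letter `s` only, and fixed by the other vertex groups.
The further letters in front of `s` that commute with it then fix `y` as well. -/
structure IsChain (Γ : SimpleGraph ι) (C : ℕ) (L : ∀ i, G i → ℕ) (s : Σ i, G i)
    (l : List (Σ i, G i)) (ρ : GraphProduct Γ G →* Perm Y) (f : Y → ℕ) (x y : Y) : Prop where
  height : IsHeight C f x y
  lipschitz : ∀ i a u, ((f (ρ (ofVertex Γ i a) u) : ℤ) - f u).natAbs ≤ L i a + 1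
  fixes : ∀ i ≠ s.1, ∀ a, ρ (ofVertex Γ i a) y = y
  apply : ρ (wordProd Γ (s :: l)) x = y
  apply_ne : ∀ l', l' <:+ l → ρ (wordProd Γ l') x ≠ y

theorem comp_toVertex_of_ne {i j : ι} (σ : G i →* Perm X) (hij : j ≠ i) (a : G j) :
    σ.comp (toVertex Γ i) (ofVertex Γ j a) = 1 := by
  rw [MonoidHom.comp_apply, toVertex_ofVertex_of_ne hij, map_one]

theorem natAbs_comp_toVertex_sub_le {i : ι} {σ : G i →* Perm X} {g : G i} {e : X → ℕ} {z : X}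
    (h : Separates C (L i) g σ e z) (j : ι) (a : G j) (u : X) :
    ((e (σ.comp (toVertex Γ i) (ofVertex Γ j a) u) : ℤ) - e u).natAbs ≤ L j a := by
  by_cases hij : j = i
  · subst hij
    rw [MonoidHom.comp_apply, toVertex_ofVertex_self]
    exact h.lipschitz a u
  · simp [comp_toVertex_of_ne σ hij]

theorem IsChain.singleton {σ : G s.1 →* Perm X} {e : X → ℕ} {z : X}
    (h : Separates C (L s.1) s.2 σ e z) :
    IsChain Γ C L s [] (σ.comp (toVertex Γ s.1)) e z (σ s.2 z) where
  height := h.height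
  lipschitz i a u := (natAbs_comp_toVertex_sub_le h i a u).trans (Nat.le_succ _)
  fixes i hi a := by rw [comp_toVertex_of_ne σ hi, Perm.one_apply]
  apply := by
    rw [wordProd_cons, wordProd_nil, mul_one, MonoidHom.comp_apply, toVertex_ofVertex_self]
  apply_ne l' hl' := by
    rw [List.suffix_nil.1 hl', wordProd_nil, map_one, Perm.one_apply]
    exact h.moves.symm

theorem suffix_of_cons_suffix_append_cons {α : Type*} {P : α → Prop} {r a : α} {l l₁ l₂ : List α}
    (h : r :: l <:+ l₁ ++ a :: l₂) (h₁ : ∀ b ∈ l₁, P b) (hr : ¬P r) : l <:+ l₂ := by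
  induction l₁ with
  | nil =>
    rcases List.suffix_cons_iff.1 h with h | h
    · exact (List.cons.inj h).2 ▸ List.suffix_rfl
    · exact (List.suffix_cons r l).trans h
  | cons b l₁ ih =>
    rw [List.forall_mem_cons] at h₁
    rcases List.suffix_cons_iff.1 h with h | h
    · exact absurd ((List.cons.inj h).1 ▸ h₁.1) hr
    · exact ih h h₁.2

theorem IsChain.apply_wordProd_append {ρ : GraphProduct Γ G →* Perm Y} {f : Y → ℕ} {x y : Y}
    (h : IsChain Γ C L s l ρ f x y) {l₁ : List (Σ i, G i)} (h₁ : ∀ r ∈ l₁, Γ.Adj r.1 s.1) :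
    ρ (wordProd Γ (l₁ ++ s :: l)) x = y := by
  induction l₁ with
  | nil => exact h.apply
  | cons r l₁ ih =>
    rw [List.forall_mem_cons] at h₁
    rw [List.cons_append, wordProd_cons, map_mul, Perm.mul_apply, ih h₁.2]
    exact h.fixes _ h₁.1.ne _

theorem IsChain.apply_eq_or_comp_toVertex_apply_eq {ρ : GraphProduct Γ G →* Perm Y} {f : Y → ℕ}
    {x y : Y} (h : IsChain Γ C L s l ρ f x y) {k : ι} (hne : k ≠ s.1) (hadj : ¬Γ.Adj k s.1)
    (σ : G k →* Perm X) (z : X) (i j : ι) (hij : i = j ∨ Γ.Adj i j) (a : G i) (b : G j) :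
    ρ (ofVertex Γ i a) y = y ∨ σ.comp (toVertex Γ k) (ofVertex Γ j b) z = z := by
  by_cases hj : j = k
  · subst hj
    refine .inl (h.fixes i ?_ a)
    rintro rfl
    exact hij.elim hne.symm fun hij => hadj hij.symm
  · exact .inr (by rw [comp_toVertex_of_ne σ hj, Perm.one_apply])

/-- The letters of the vertex group `k` in the word are those of `l`, and these act before the path
has reached `y`. -/
theorem IsChain.wedgeAction_wordProd_inl {ρ : GraphProduct Γ G →* Perm Y} {f : Y → ℕ} {x y : Y}
    (h : IsChain Γ C L s l ρ f x y) {l₁ : List (Σ i, G i)} (h₁ : ∀ r ∈ l₁, Γ.Adj r.1 s.1) {k : ι}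
    (hne : k ≠ s.1) (hadj : ¬Γ.Adj k s.1) (σ : G k →* Perm X) (z : X) {l' : List (Σ i, G i)}
    (hl' : l' <:+ l₁ ++ s :: l) :
    wedgeAction ρ (σ.comp (toVertex Γ k)) y z
      (h.apply_eq_or_comp_toVertex_apply_eq hne hadj σ z) (wordProd Γ l') (.inl x) =
        .inl (ρ (wordProd Γ l') x) := by
  induction l' with
  | nil => simp
  | cons r l' ih =>
    rw [wordProd_cons, map_mul, Perm.mul_apply, ih ((List.suffix_cons r l').trans hl'),
      wedgeAction_ofVertex, wedgePerm_inl fun hy => ?_, map_mul, Perm.mul_apply]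
    by_cases hr : r.1 = k
    · exact absurd hy (h.apply_ne l' (suffix_of_cons_suffix_append_cons hl' h₁ (hr ▸ hadj)))
    · rw [comp_toVertex_of_ne σ hr, Perm.one_apply]

theorem IsChain.exists_cons {ρ : GraphProduct Γ G →* Perm Y} {f : Y → ℕ} {x y : Y}
    (h : IsChain Γ C L s l ρ f x y) {l₁ : List (Σ i, G i)} (h₁ : ∀ r ∈ l₁, Γ.Adj r.1 s.1)
    (hne : t.1 ≠ s.1) (hadj : ¬Γ.Adj t.1 s.1) {σ : G t.1 →* Perm X} {e : X → ℕ} {z : X}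
    (ht : Separates C (L t.1) t.2 σ e z) :
    ∃ (Z : Type) (ρ' : GraphProduct Γ G →* Perm Z) (f' : Z → ℕ) (x' y' : Z),
      IsChain Γ C L t (l₁ ++ s :: l) ρ' f' x' y' := by
  have hfix := h.apply_eq_or_comp_toVertex_apply_eq hne hadj σ z
  refine ⟨Wedge Y z, wedgeAction ρ (σ.comp (toVertex Γ t.1)) y z hfix, wedgeHeight f y e, .inl x,
    wedgeInr y z (σ t.2 z), h.height.wedge ht.height ht.moves, fun i a w => ?_, fun i hi a => ?_,
    ?_, fun l' hl' => ?_⟩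
  · rw [wedgeAction_ofVertex]
    exact natAbs_wedgeHeight_sub_le (hfix i i (.inl rfl) a a) ht.height.bot (h.lipschitz i a)
      (natAbs_comp_toVertex_sub_le ht i a) w
  · rw [wedgeAction_ofVertex, comp_toVertex_of_ne σ hi]
    exact wedgePerm_wedgeInr fun hv => absurd hv ht.moves
  · rw [wordProd_cons, map_mul, Perm.mul_apply,
      h.wedgeAction_wordProd_inl h₁ hne hadj σ z List.suffix_rfl, h.apply_wordProd_append h₁,
      wedgeAction_ofVertex, ← wedgeInr_self y z, wedgePerm_wedgeInr fun _ => h.fixes _ hne _,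
      MonoidHom.comp_apply, toVertex_ofVertex_self]
  · rw [h.wedgeAction_wordProd_inl h₁ hne hadj σ z hl', wedgeInr_of_ne y ht.moves]
    exact Sum.inl_ne_inr

theorem exists_isChain (hL : ∀ i, ∀ g : G i, g ≠ 1 →
      ∃ (X : Type) (σ : G i →* Perm X) (e : X → ℕ) (z : X), Separates C (L i) g σ e z)
    (hl : IsGeodesicWord Γ (t :: l)) :
    ∃ l₁ s l₂, t :: l = l₁ ++ s :: l₂ ∧ (∀ r ∈ l₁, Γ.Adj r.1 s.1) ∧
      ∃ (Y : Type) (ρ : GraphProduct Γ G →* Perm Y) (f : Y → ℕ) (x y : Y),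
        IsChain Γ C L s l₂ ρ f x y := by
  induction l generalizing t with
  | nil =>
    obtain ⟨X, σ, e, z, ht⟩ := hL t.1 t.2 hl.ne_one
    exact ⟨[], t, [], rfl, by simp, X, _, e, z, _, IsChain.singleton ht⟩
  | cons t' l ih =>
    obtain ⟨l₁, s, l₂, hl', h₁, Y, ρ, f, x, y, hchain⟩ := ih hl.tail
    rw [hl'] at hl ⊢
    by_cases hadj : Γ.Adj t.1 s.1
    · exact ⟨t :: l₁, s, l₂, rfl, List.forall_mem_cons.2 ⟨hadj, h₁⟩, Y, ρ, f, x, y, hchain⟩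
    · obtain ⟨X, σ, e, z, ht⟩ := hL t.1 t.2 hl.ne_one
      exact ⟨[], t, _, rfl, by simp, hchain.exists_cons h₁ (hl.ne_of_adj h₁) hadj ht⟩

theorem LinearlySeparated.graphProduct (Γ : SimpleGraph ι)
    (hG : ∀ i, LinearlySeparated C ({1}ᶜ : Set (G i))) :
    LinearlySeparated C ({1}ᶜ : Set (GraphProduct Γ G)) := by
  choose L hL using hG
  obtain ⟨K, hK⟩ := exists_lipschitz_of_closure_eq_top (closure_range_ofVertex (Γ := Γ))
    fun s : Σ i, G i => L s.1 s.2 + 1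
  refine ⟨K, fun w hw => ?_⟩
  obtain ⟨_ | ⟨t, l⟩, rfl, hl⟩ := exists_isGeodesicWord w
  · exact absurd wordProd_nil hw
  · obtain ⟨l₁, s, l₂, hl', h₁, Y, ρ, f, x, y, h⟩ := exists_isChain hL hl
    have happly : ρ (wordProd Γ (t :: l)) x = y := hl' ▸ h.apply_wordProd_append h₁
    have hxy : y ≠ x := fun hyx => h.apply_ne [] l₂.nil_suffix (by simp [hyx])
    exact ⟨Y, ρ, f, x, happly ▸ h.height, happly ▸ hxy, hK ρ f fun s => h.lipschitz s.1 s.2⟩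

theorem exists_linearlySeparated_graphProduct [Finite ι] (Γ : SimpleGraph ι)
    (hG : ∀ i, ∃ C, LinearlySeparated C ({1}ᶜ : Set (G i))) :
    ∃ C, LinearlySeparated C ({1}ᶜ : Set (GraphProduct Γ G)) := by
  choose C hC using hG
  obtain ⟨K, hK⟩ := (Set.finite_range C).bddAbove
  exact ⟨K, .graphProduct Γ fun i => (hC i).mono (hK (Set.mem_range_self i))⟩

end Chain

/-! ### Lamplighter groups -/

section Lamplighter

variable {p : ℕ}

theorem toAdd_lampShift (n : Multiplicative ℤ) (f : Multiplicative (ℤ →₀ ZMod p)) :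
    (lampShift p n f).toAdd = f.toAdd.mapDomain (· + n.toAdd) :=
  Finsupp.equivMapDomain_eq_mapDomain (Equiv.addRight n.toAdd) _

/-- The configuration of lamps read modulo `m`: the state at `j` is the sum of the states of the
lamps congruent to `j`. -/
def foldLamps (p m : ℕ) : (ℤ →₀ ZMod p) →+ (ZMod m →₀ ZMod p) :=
  Finsupp.mapDomain.addMonoidHom Int.cast

theorem foldLamps_mapDomain_add_right (m : ℕ) (f : ℤ →₀ ZMod p) (n : ℤ) (j : ZMod m) :
    foldLamps p m (f.mapDomain (· + n)) j = foldLamps p m f (j - n) := by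
  have hcomm : foldLamps p m (f.mapDomain (· + n)) =
      (foldLamps p m f).mapDomain (· + (n : ZMod m)) := by
    simp only [foldLamps, Finsupp.mapDomain.addMonoidHom_apply, ← Finsupp.mapDomain_comp]
    congr 1
    ext i
    simp
  rw [hcomm]
  conv_lhs => rw [← sub_add_cancel j (n : ZMod m)]
  exact Finsupp.mapDomain_apply (add_left_injective _) _ _

/-- Configurations of lamps act fibrewise on `m` copies of `ℤ/p`, the `j`-th one being translated by
the state of the lamp `j` modulo `m`. -/
def lampTranslation (p m : ℕ) :
    Multiplicative (ℤ →₀ ZMod p) →* Perm (ZMod m × ZMod p) where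
  toFun f := Equiv.prodCongrRight fun j => Equiv.addRight (foldLamps p m f.toAdd j)
  map_one' := by ext <;> simp
  map_mul' f f' := by
    ext ⟨j, z⟩
    · rfl
    · simp [add_comm, add_left_comm]

/-- The lamplighter's moves permute `m` copies of `ℤ/p` cyclically. -/
def fiberRotation (p m : ℕ) : Multiplicative ℤ →* Perm (ZMod m × ZMod p) where
  toFun n := Equiv.prodCongrLeft fun _ => rotation m n
  map_one' := by ext <;> simp
  map_mul' n n' := by ext <;> simp

/-- The imprimitive action of the lamplighter group on `m` copies of `ℤ/p` arranged in a cycle. -/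
def lampAction (p m : ℕ) : Lamplighter p →* Perm (ZMod m × ZMod p) :=
  SemidirectProduct.lift (lampTranslation p m) (fiberRotation p m) fun n => by
    refine MonoidHom.ext fun f => eq_mul_inv_iff_mul_eq.2 ?_
    ext ⟨j, z⟩
    · rfl
    · simp [lampTranslation, fiberRotation, rotation_apply, toAdd_lampShift,
        foldLamps_mapDomain_add_right]

theorem lampAction_inl (m : ℕ) (f : Multiplicative (ℤ →₀ ZMod p)) (u : ZMod m × ZMod p) :
    lampAction p m (SemidirectProduct.inl f) u = (u.1, u.2 + foldLamps p m f.toAdd u.1) := by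
  rw [lampAction, SemidirectProduct.lift_inl]
  rfl

theorem lampAction_inr (m : ℕ) (n : Multiplicative ℤ) (u : ZMod m × ZMod p) :
    lampAction p m (SemidirectProduct.inr n) u = (u.1 + (n.toAdd : ℤ), u.2) := by
  rw [lampAction, SemidirectProduct.lift_inr, ← rotation_apply]
  rfl

/-- The generator that switches the lamp at `0`. -/
def lampSwitch (p : ℕ) : Lamplighter p :=
  SemidirectProduct.inl (.ofAdd (Finsupp.single 0 1))

/-- The generator that moves the lamplighter by one step. -/
def lampMove (p : ℕ) : Lamplighter p :=
  SemidirectProduct.inr (.ofAdd 1)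

theorem closure_lampSwitch_lampMove (p : ℕ) [NeZero p] :
    Subgroup.closure {lampSwitch p, lampMove p} = ⊤ := by
  set H := Subgroup.closure {lampSwitch p, lampMove p}
  have hswitch : lampSwitch p ∈ H := Subgroup.subset_closure (by simp)
  have hmove : lampMove p ∈ H := Subgroup.subset_closure (by simp)
  have hinr (n : Multiplicative ℤ) : (SemidirectProduct.inr n : Lamplighter p) ∈ H := by
    have hn : n = .ofAdd 1 ^ n.toAdd := by rw [← ofAdd_zsmul]; simp
    rw [hn, map_zpow]
    exact H.zpow_mem hmove _
  have hinl (f : ℤ →₀ ZMod p) : (SemidirectProduct.inl (.ofAdd f) : Lamplighter p) ∈ H := by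
    induction f using Finsupp.induction_linear with
    | zero => exact map_one (SemidirectProduct.inl (φ := lampShift p)) ▸ H.one_mem
    | add f f' hf hf' => rw [ofAdd_add, map_mul]; exact H.mul_mem hf hf'
    | single i c =>
      have hconj : Multiplicative.ofAdd (Finsupp.single i c) =
          lampShift p (.ofAdd i) (.ofAdd (Finsupp.single 0 1) ^ c.val) := by
        apply Multiplicative.toAdd.injective
        simp [toAdd_lampShift, Finsupp.mapDomain_single]
      rw [hconj, SemidirectProduct.inl_aut, map_pow]
      exact H.mul_mem (H.mul_mem (hinr _) (H.pow_mem hswitch _)) (hinr _)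
  refine (Subgroup.eq_top_iff' _).2 fun g => ?_
  rw [← SemidirectProduct.inl_left_mul_inr_right g]
  exact H.mul_mem (hinl g.left.toAdd) (hinr _)

theorem fg_lamplighter (p : ℕ) [NeZero p] : Group.FG (Lamplighter p) :=
  Group.fg_iff.2 ⟨_, closure_lampSwitch_lampMove p, by simp⟩

theorem injOn_intCast_zmod (N : ℕ) :
    Set.InjOn (Int.cast : ℤ → ZMod (2 * N + 1)) {i | i.natAbs ≤ N} := by
  intro a (ha : a.natAbs ≤ N) b (hb : b.natAbs ≤ N) hab
  have hdvd := (ZMod.intCast_eq_intCast_iff_dvd_sub a b _).1 hab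
  have := Int.eq_zero_of_abs_lt_dvd hdvd (abs_lt.2 ⟨by omega, by omega⟩)
  omega

theorem exists_foldLamps_ne_zero {f : ℤ →₀ ZMod p} (hf : f ≠ 0) :
    ∃ (N : ℕ) (j : ZMod (2 * N + 1)), j.valMinAbs.natAbs = N ∧ foldLamps p (2 * N + 1) f j ≠ 0 := by
  obtain ⟨i, hi, hmax⟩ := f.support.exists_max_image Int.natAbs (Finsupp.support_nonempty_iff.2 hf)
  refine ⟨i.natAbs, (i : ZMod _), ?_, ?_⟩
  · rw [(ZMod.valMinAbs_spec _ i).2 ⟨rfl, by rw [Set.mem_Ioc]; omega⟩]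
  · rw [foldLamps, Finsupp.mapDomain.addMonoidHom_apply,
      Finsupp.mapDomain_apply' _ _ hmax (injOn_intCast_zmod _) (le_refl i.natAbs)]
    exact Finsupp.mem_support_iff.1 hi

/-- A height on the cycle of copies of `ℤ/p`, whose size is the distance to the copy at `0`. The
sign tells whether the lamp is off, so that switching a lamp far from `0` changes the height by a
large amount. -/
def lampHeight {m : ℕ} (u : ZMod m × ZMod p) : ℤ :=
  if u.2 = 0 then u.1.valMinAbs.natAbs else -1 - u.1.valMinAbs.natAbs

theorem encard_lampHeight_eq_le {m : ℕ} [NeZero p] (c : ℤ) :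
    {u : ZMod m × ZMod p | lampHeight u = c}.encard ≤ (2 * p : ℕ) := by
  let k := (if 0 ≤ c then c else -1 - c).natAbs
  have hsub : {u : ZMod m × ZMod p | lampHeight u = c} ⊆
      {j | j.valMinAbs.natAbs = k} ×ˢ Set.univ := by
    rintro ⟨j, z⟩ (hu : lampHeight (j, z) = c)
    refine ⟨?_, trivial⟩
    simp only [lampHeight] at hu
    simp only [Set.mem_ofPred_eq, k]
    split_ifs at hu ⊢ <;> omega
  calc {u : ZMod m × ZMod p | lampHeight u = c}.encard
      ≤ {j : ZMod m | j.valMinAbs.natAbs = k}.encard * (Set.univ : Set (ZMod p)).encard :=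
        (Set.encard_le_encard hsub).trans_eq Set.encard_prod
    _ ≤ 2 * p := by
        gcongr
        · exact encard_natAbs_valMinAbs_eq_le_two m k
        · simp
    _ = (2 * p : ℕ) := by norm_cast

theorem natAbs_lampHeight_lampMove_sub_le {m : ℕ} [NeZero m] (u : ZMod m × ZMod p) :
    (lampHeight (lampAction p m (lampMove p) u) - lampHeight u).natAbs ≤ 1 := by
  have := natAbs_valMinAbs_add_intCast_sub_le u.1 1
  rw [lampMove, lampAction_inr]
  simp only [lampHeight, toAdd_ofAdd]
  split_ifs <;> omega

theorem natAbs_lampHeight_lampSwitch_sub_le {m : ℕ} (u : ZMod m × ZMod p) :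
    (lampHeight (lampAction p m (lampSwitch p) u) - lampHeight u).natAbs ≤ 1 := by
  rw [lampSwitch, lampAction_inl]
  by_cases hu : u.1 = 0
  · simp only [lampHeight, hu, ZMod.valMinAbs_zero]
    split_ifs <;> simp
  · have : foldLamps p m (Finsupp.single 0 1) u.1 = 0 := by
      simp [foldLamps, Finsupp.mapDomain_single, Ne.symm hu]
    simp [this]

theorem natAbs_lampHeight_sub_le (N : ℕ) (u v : ZMod (2 * N + 1) × ZMod p) :
    (lampHeight u - lampHeight v).natAbs ≤ 2 * N + 1 := by
  have hu := ZMod.natAbs_valMinAbs_le u.1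
  have hv := ZMod.natAbs_valMinAbs_le v.1
  simp only [lampHeight]
  split_ifs <;> omega

theorem linearlySeparated_lamplighter_ker (p : ℕ) [NeZero p] :
    LinearlySeparated (2 * (2 * 1 + 1) * (2 * p))
      {g : Lamplighter p | g.right = 1 ∧ g ≠ 1} := by
  refine .of_displacement (K := 1) (closure_lampSwitch_lampMove p) fun g ⟨hright, hg⟩ => ?_
  have hinl : g = SemidirectProduct.inl g.left := SemidirectProduct.ext rfl hright
  have hleft : g.left.toAdd ≠ 0 := fun h => hg (SemidirectProduct.ext h hright)
  obtain ⟨N, j, hjN, hj⟩ := exists_foldLamps_ne_zero hleft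
  have hstart : lampHeight (j, (0 : ZMod p)) = N := by simp [lampHeight, hjN]
  have hend : lampHeight (lampAction p _ g (j, 0)) = -1 - N := by
    rw [hinl, lampAction_inl]
    simp [lampHeight, hj, hjN]
  refine ⟨_, lampAction p (2 * N + 1), lampHeight, (j, 0), ?_, fun u v => ?_, ?_,
    encard_lampHeight_eq_le⟩
  · omega
  · have := natAbs_lampHeight_sub_le N u v
    omega
  · rintro s (rfl | rfl) u
    · exact natAbs_lampHeight_lampSwitch_sub_le u
    · exact natAbs_lampHeight_lampMove_sub_le u

theorem exists_linearlySeparated_lamplighter (p : ℕ) [NeZero p] :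
    ∃ C, LinearlySeparated C ({1}ᶜ : Set (Lamplighter p)) := by
  have hmoves := linearlySeparated_int.comap (SemidirectProduct.rightHom (φ := lampShift p))
  have hlamps := linearlySeparated_lamplighter_ker p
  refine ⟨_, ((hmoves.mono (le_max_left _ _)).union
    (hlamps.mono (le_max_right _ _))).subset fun g hg => ?_⟩
  by_cases hright : g.right = 1
  · exact .inr ⟨hright, hg⟩
  · exact .inl hright

end Lamplighter

/-! ### The Grigorchuk group -/

section Grigorchuk

@[simp]
theorem grigA_apply (l : List Bool) : grigA l = grigAFun l := rfl

@[simp]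
theorem grigB_apply (l : List Bool) : grigB l = grigBFun l := rfl

@[simp]
theorem grigC_apply (l : List Bool) : grigC l = grigCFun l := rfl

@[simp]
theorem grigD_apply (l : List Bool) : grigD l = grigDFun l := rfl

theorem grigA_mem : grigA ∈ grigorchukGroup :=
  Subgroup.subset_closure (by simp)

theorem grigB_mem : grigB ∈ grigorchukGroup :=
  Subgroup.subset_closure (by simp)

theorem grigC_mem : grigC ∈ grigorchukGroup :=
  Subgroup.subset_closure (by simp)

theorem grigD_mem : grigD ∈ grigorchukGroup :=
  Subgroup.subset_closure (by simp)

/-- The generators `a, b, c, d` as elements of the Grigorchuk group. -/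
def grigGens : Set grigorchukGroup :=
  {⟨grigA, grigA_mem⟩, ⟨grigB, grigB_mem⟩, ⟨grigC, grigC_mem⟩, ⟨grigD, grigD_mem⟩}

theorem closure_grigGens : Subgroup.closure grigGens = ⊤ := by
  refine Eq.trans ?_ (Subgroup.closure_closure_coe_preimage (k := {grigA, grigB, grigC, grigD}))
  congr 1
  ext ⟨g, hg⟩
  simp only [grigGens, Set.mem_insert_iff, Set.mem_singleton_iff, Subtype.mk.injEq]
  rfl

theorem fg_grigorchuk : Group.FG grigorchukGroup :=
  Group.fg_iff.2 ⟨_, closure_grigGens, by simp [grigGens]⟩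

/-- The generators being involutions, membership in the group they generate needs no inverses. -/
theorem grigorchuk_induction {P : (g : Perm (List Bool)) → g ∈ grigorchukGroup → Prop}
    (a : P grigA grigA_mem) (b : P grigB grigB_mem) (c : P grigC grigC_mem)
    (d : P grigD grigD_mem) (one : P 1 (one_mem _))
    (mul : ∀ g h hg hh, P g hg → P h hh → P (g * h) (mul_mem hg hh))
    {g : Perm (List Bool)} (hg : g ∈ grigorchukGroup) : P g hg := by
  induction hg using Subgroup.closure_induction'' with
  | mem s hs =>
    rcases hs with rfl | rfl | rfl | rfl
    exacts [a, b, c, d]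
  | inv_mem s hs =>
    rcases hs with rfl | rfl | rfl | rfl
    exacts [a, b, c, d]
  | one => exact one
  | mul g h hg hh ihg ihh => exact mul g h hg hh ihg ihh

theorem length_grigAFun (l : List Bool) : (grigAFun l).length = l.length := by
  cases l <;> simp [grigAFun]

theorem length_grigBCDFun (l : List Bool) : (grigBFun l).length = l.length ∧
    (grigCFun l).length = l.length ∧ (grigDFun l).length = l.length := by
  induction l with
  | nil => simp [grigBFun, grigCFun, grigDFun]
  | cons x l ih =>
    obtain ⟨hb, hc, hd⟩ := ih
    cases x <;> simp [grigBFun, grigCFun, grigDFun, length_grigAFun, hb, hc, hd]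

variable {g : Perm (List Bool)}

theorem length_apply_of_mem_grigorchuk (hg : g ∈ grigorchukGroup) (l : List Bool) :
    (g l).length = l.length := by
  induction hg using grigorchuk_induction generalizing l with
  | a => exact length_grigAFun l
  | b => exact (length_grigBCDFun l).1
  | c => exact (length_grigBCDFun l).2.1
  | d => exact (length_grigBCDFun l).2.2
  | one => rfl
  | mul g h _ _ ihg ihh => rw [Perm.mul_apply, ihg, ihh]

theorem exists_section_cons (hg : g ∈ grigorchukGroup) (x : Bool) :
    ∃ y, ∃ h ∈ grigorchukGroup, ∀ t, g (x :: t) = y :: h t := by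
  induction hg using grigorchuk_induction generalizing x with
  | a => exact ⟨!x, 1, one_mem _, fun t => rfl⟩
  | b =>
    cases x
    · exact ⟨false, grigA, grigA_mem, fun t => by simp [grigBFun]⟩
    · exact ⟨true, grigC, grigC_mem, fun t => by simp [grigBFun]⟩
  | c =>
    cases x
    · exact ⟨false, grigA, grigA_mem, fun t => by simp [grigCFun]⟩
    · exact ⟨true, grigD, grigD_mem, fun t => by simp [grigCFun]⟩
  | d =>
    cases x
    · exact ⟨false, 1, one_mem _, fun t => by simp [grigDFun]⟩
    · exact ⟨true, grigB, grigB_mem, fun t => by simp [grigDFun]⟩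
  | one => exact ⟨x, 1, one_mem _, fun t => rfl⟩
  | mul g h _ _ ihg ihh =>
    obtain ⟨y, k, hk, hy⟩ := ihh x
    obtain ⟨z, k', hk', hz⟩ := ihg y
    exact ⟨z, k' * k, mul_mem hk' hk, fun t => by
      rw [Perm.mul_apply, hy, hz, Perm.mul_apply]⟩

theorem exists_section (hg : g ∈ grigorchukGroup) (v : List Bool) :
    ∃ h ∈ grigorchukGroup, ∀ t, g (v ++ t) = g v ++ h t := by
  induction v generalizing g with
  | nil =>
    have hnil : g [] = [] := List.length_eq_zero_iff.1 (length_apply_of_mem_grigorchuk hg [])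
    exact ⟨g, hg, fun t => by rw [List.nil_append, hnil, List.nil_append]⟩
  | cons x v ih =>
    obtain ⟨y, h, hh, hy⟩ := exists_section_cons hg x
    obtain ⟨k, hk, hv⟩ := ih hh
    exact ⟨k, hk, fun t => by rw [List.cons_append, hy, hy, hv, List.cons_append]⟩

theorem apply_append_singleton_of_ne (hg : g ∈ grigorchukGroup) {u : List Bool} {e : Bool}
    (hu : g u = u) (hne : g (u ++ [e]) ≠ u ++ [e]) : g (u ++ [e]) = u ++ [!e] := by
  obtain ⟨h, hh, hs⟩ := exists_section hg u
  rw [hs, hu] at hne ⊢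
  obtain ⟨y, hy⟩ := List.length_eq_one_iff.1 (length_apply_of_mem_grigorchuk hh [e])
  rw [hy] at hne ⊢
  rw [Bool.eq_not.2 fun hye : y = e => hne (hye ▸ rfl)]

/-- The action of the Grigorchuk group on the `n`-th level of the tree. -/
def levelHom (n : ℕ) : grigorchukGroup →* Perm (List.Vector Bool n) where
  toFun g := Perm.subtypePerm g.1 fun l => by rw [length_apply_of_mem_grigorchuk g.2]
  map_one' := rfl
  map_mul' _ _ := rfl

theorem levelHom_eq_one_iff {n : ℕ} (hg : g ∈ grigorchukGroup) :
    levelHom n ⟨g, hg⟩ = 1 ↔ ∀ l : List Bool, l.length = n → g l = l :=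
  ⟨fun h l hl => congrArg Subtype.val (DFunLike.congr_fun h (⟨l, hl⟩ : List.Vector Bool n)),
    fun h => Equiv.ext fun l => Subtype.ext (h l.1 l.2)⟩

/-! ### The Gray code -/

/-- The position of a word in the Schreier graph of its level, which is a line (up to loops and
multiple edges) on which the words are ordered by a Gray code. -/
def grayPos : List Bool → ℕ
  | [] => 0
  | x :: t => 2 * grayPos t + (grayPos t + if x then 0 else 1) % 2

theorem grayPos_cons_div_two (x : Bool) (t : List Bool) : grayPos (x :: t) / 2 = grayPos t := by
  rw [grayPos]; omega

theorem grayPos_lt (l : List Bool) : grayPos l < 2 ^ l.length := by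
  induction l with
  | nil => simp [grayPos]
  | cons x t ih => rw [grayPos, List.length_cons, pow_succ]; omega

theorem eq_of_grayPos_eq {l l' : List Bool} (hl : l.length = l'.length)
    (h : grayPos l = grayPos l') : l = l' := by
  induction l generalizing l' with
  | nil => exact (List.length_eq_zero_iff.1 hl.symm).symm
  | cons x t ih =>
    obtain _ | ⟨x', t'⟩ := l'
    · simp at hl
    · have ht : grayPos t = grayPos t' := by
        rw [← grayPos_cons_div_two x t, ← grayPos_cons_div_two x' t', h]
      obtain rfl := ih (by simpa using hl) ht
      cases x <;> cases x' <;> simp [grayPos] at h ⊢ <;> omega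

theorem grayPos_append_div_pow (v t : List Bool) :
    grayPos (v ++ t) / 2 ^ v.length = grayPos t := by
  induction v with
  | nil => simp
  | cons x v ih =>
    rw [List.cons_append, List.length_cons, pow_succ', ← Nat.div_div_eq_div_mul,
      grayPos_cons_div_two, ih]

theorem grayPos_append_not (u : List Bool) (e : Bool) :
    grayPos (u ++ [!e]) + grayPos (u ++ [e]) + 1 = 2 ^ (u.length + 1) := by
  induction u with
  | nil => cases e <;> rfl
  | cons x u ih =>
    rw [List.cons_append, List.cons_append, grayPos, grayPos, List.length_cons, pow_succ, ← ih]
    have := pow_succ 2 u.length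
    omega

theorem grayPos_grigAFun_div_two (l : List Bool) : grayPos (grigAFun l) / 2 = grayPos l / 2 := by
  cases l with
  | nil => rfl
  | cons x t => rw [grigAFun, grayPos_cons_div_two, grayPos_cons_div_two]

theorem grayPos_grigBCDFun_add_one_div_two (l : List Bool) :
    (grayPos (grigBFun l) + 1) / 2 = (grayPos l + 1) / 2 ∧
    (grayPos (grigCFun l) + 1) / 2 = (grayPos l + 1) / 2 ∧
    (grayPos (grigDFun l) + 1) / 2 = (grayPos l + 1) / 2 := by
  induction l with
  | nil => simp [grigBFun, grigCFun, grigDFun]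
  | cons x t ih =>
    have ha := grayPos_grigAFun_div_two t
    obtain ⟨hb, hc, hd⟩ := ih
    cases x <;> simp only [grigBFun, grigCFun, grigDFun, grayPos] <;> simp <;> omega

theorem natAbs_grayPos_sub_le {s : grigorchukGroup} (hs : s ∈ grigGens) (l : List Bool) :
    ((grayPos (s.1 l) : ℤ) - grayPos l).natAbs ≤ 1 := by
  have ha := grayPos_grigAFun_div_two l
  obtain ⟨hb, hc, hd⟩ := grayPos_grigBCDFun_add_one_div_two l
  rcases hs with rfl | rfl | rfl | rfl <;>
    simp only [grigA_apply, grigB_apply, grigC_apply, grigD_apply] <;> omega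

/-! ### Displacement in the Grigorchuk group -/

theorem eq_one_of_sign_eq_one_of_card_support_le_two {α : Type*} [Fintype α] [DecidableEq α]
    {σ : Perm α} (hsign : Perm.sign σ = 1) (hcard : σ.support.card ≤ 2) : σ = 1 := by
  have hne : σ.support.card ≠ 2 := fun h => by
    rw [(Perm.card_support_eq_two.1 h).sign_eq] at hsign
    exact absurd hsign (by decide)
  have := σ.card_support_ne_one
  exact Perm.card_support_eq_zero.1 (by omega)

theorem sign_levelHom_four (g : grigorchukGroup) :
    Perm.sign (levelHom 4 g) = Perm.sign (levelHom 2 g) * Perm.sign (levelHom 3 g) := by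
  have h : Perm.sign.comp (levelHom 4) =
      Perm.sign.comp (levelHom 2) * Perm.sign.comp (levelHom 3) := by
    refine MonoidHom.eq_of_eqOn_dense closure_grigGens ?_
    rintro _ (rfl | rfl | rfl | rfl) <;>
      simp only [MonoidHom.comp_apply, MonoidHom.mul_apply] <;> decide
  exact DFunLike.congr_fun h g

/-- By parity, `g` cannot just swap the two words in the middle of the fourth level. -/
theorem exists_moved_off_middle (hg : g ∈ grigorchukGroup)
    (hfix : ∀ l : List Bool, l.length ≤ 3 → g l = l) {l₀ : List Bool} (h₀ : l₀.length = 4)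
    (hl₀ : g l₀ ≠ l₀) :
    ∃ l : List Bool, l.length = 4 ∧ g l ≠ l ∧ grayPos l ≠ 7 ∧ grayPos l ≠ 8 := by
  by_contra! hmid
  have hsign : Perm.sign (levelHom 4 ⟨g, hg⟩) = 1 := by
    have h2 := (levelHom_eq_one_iff hg).2 fun l (hl : l.length = 2) => hfix l (by omega)
    have h3 := (levelHom_eq_one_iff hg).2 fun l (hl : l.length = 3) => hfix l hl.le
    rw [sign_levelHom_four, h2, h3, map_one, map_one, one_mul]
  have hcard : (levelHom 4 ⟨g, hg⟩).support.card ≤ ({7, 8} : Finset ℕ).card := by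
    refine Finset.card_le_card_of_injOn (fun l => grayPos l.1) (fun l hl => ?_)
      fun l _ l' _ h => Subtype.ext (eq_of_grayPos_eq (l.2.trans l'.2.symm) h)
    have hne : g l.1 ≠ l.1 := fun h => Perm.mem_support.1 hl (Subtype.ext h)
    have := hmid l.1 l.2 hne
    rw [Finset.mem_coe, Finset.mem_insert, Finset.mem_singleton]
    tauto
  exact hl₀ ((levelHom_eq_one_iff hg).1
    (eq_one_of_sign_eq_one_of_card_support_le_two hsign hcard) l₀ h₀)

theorem exists_moved_off_middle_append (hg : g ∈ grigorchukGroup) {v l₀ : List Bool}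
    (hfix : ∀ t : List Bool, t.length < v.length + 4 → g t = t) (h₀ : l₀.length = 4)
    (hl₀ : g (v ++ l₀) ≠ v ++ l₀) :
    ∃ l : List Bool, l.length = v.length + 4 ∧ g l ≠ l ∧
      (grayPos l < 7 * 2 ^ v.length ∨ 9 * 2 ^ v.length ≤ grayPos l) := by
  obtain ⟨h, hh, hs⟩ := exists_section hg v
  have happend (t : List Bool) : g (v ++ t) = v ++ t ↔ h t = t := by
    rw [hs, hfix v (by omega), List.append_cancel_left_eq]
  obtain ⟨l, hl, hne, h7, h8⟩ := exists_moved_off_middle hh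
    (fun t ht => (happend t).1 (hfix _ (by rw [List.length_append]; omega))) h₀
    (mt (happend l₀).2 hl₀)
  refine ⟨v ++ l, by rw [List.length_append, hl], mt (happend l).1 hne, ?_⟩
  have hpos : 0 < 2 ^ v.length := by positivity
  rw [← Nat.div_lt_iff_lt_mul hpos, ← Nat.le_div_iff_mul_le hpos, grayPos_append_div_pow]
  omega

theorem grayPos_apply_add_grayPos (hg : g ∈ grigorchukGroup) {l : List Bool}
    (hfix : ∀ t : List Bool, t.length < l.length → g t = t) (hne : g l ≠ l) :
    grayPos (g l) + grayPos l + 1 = 2 ^ l.length := by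
  obtain rfl | ⟨u, e, rfl⟩ := l.eq_nil_or_concat'
  · exact absurd (List.length_eq_zero_iff.1 (length_apply_of_mem_grigorchuk hg [])) hne
  · have hu : g u = u := hfix u (by simp)
    rw [apply_append_singleton_of_ne hg hu hne, grayPos_append_not, List.length_append,
      List.length_singleton]

theorem exists_two_pow_le_grayPos_sub (hg : g ∈ grigorchukGroup) (h1 : g ≠ 1) :
    ∃ l : List Bool, 2 ^ l.length ≤ 8 * ((grayPos (g l) : ℤ) - grayPos l).natAbs := by
  obtain ⟨l, hne, hmin⟩ := WellFounded.has_min (measure List.length).wf {l | g l ≠ l}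
    (Function.ne_iff.1 fun h => h1 (DFunLike.coe_injective h))
  have hfix (t : List Bool) (ht : t.length < l.length) : g t = t :=
    not_not.1 fun hne => hmin t hne ht
  obtain hn | hn := le_or_gt l.length 3
  · have hpos : grayPos (g l) ≠ grayPos l := fun h =>
      hne (eq_of_grayPos_eq (length_apply_of_mem_grigorchuk hg l) h)
    have hpow : 2 ^ l.length ≤ 2 ^ 3 := Nat.pow_le_pow_right two_pos hn
    exact ⟨l, by omega⟩
  obtain ⟨v, l₀, rfl, h₀⟩ : ∃ v l₀, l = v ++ l₀ ∧ l₀.length = 4 :=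
    ⟨l.take (l.length - 4), l.drop (l.length - 4), (List.take_append_drop _ _).symm, by
      rw [List.length_drop]; omega⟩
  rw [List.length_append, h₀] at hfix
  obtain ⟨l', hl', hne', hoff⟩ := exists_moved_off_middle_append hg hfix h₀ hne
  have hreflect := grayPos_apply_add_grayPos hg (hl' ▸ hfix) hne'
  rw [hl', pow_add] at hreflect
  exact ⟨l', by rw [hl', pow_add]; omega⟩

theorem linearlySeparated_grigorchuk :
    LinearlySeparated (2 * (2 * 8 + 1) * 1) ({1}ᶜ : Set grigorchukGroup) := by
  refine .of_displacement (K := 1) closure_grigGens fun g hg => ?_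
  obtain ⟨l, hl⟩ := exists_two_pow_le_grayPos_sub g.2 fun h => hg (Subtype.ext h)
  refine ⟨List.Vector Bool l.length, levelHom l.length, fun u => grayPos u.toList, ⟨l, rfl⟩, ?_,
    fun u v => ?_, fun s hs u => natAbs_grayPos_sub_le hs u.toList, fun c => ?_⟩
  · have := Nat.two_pow_pos l.length
    change (grayPos (g.1 l) : ℤ) ≠ grayPos l
    omega
  · have hu := grayPos_lt u.toList
    have hv := grayPos_lt v.toList
    rw [u.toList_length] at hu
    rw [v.toList_length] at hv
    change ((grayPos u.toList : ℤ) - grayPos v.toList).natAbs ≤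
      8 * ((grayPos (g.1 l) : ℤ) - grayPos l).natAbs
    omega
  · exact Set.encard_le_one_iff.2 fun u v hu hv => Subtype.ext
      (eq_of_grayPos_eq (u.2.trans v.2.symm) (Nat.cast_injective (hu.trans hv.symm)))

end Grigorchuk

/-! ### The listed groups -/

theorem IsListedGroup.fg {G : Type u} [Group G] (h : IsListedGroup.{u, v} G) : Group.FG G := by
  rcases h with h | ⟨h, -⟩ | ⟨V, Γ, H, hH, ⟨e⟩⟩ | ⟨⟨e⟩⟩ | ⟨p, hp, ⟨e⟩⟩
  · infer_instance
  · exact h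
  · have := (Group.fg_iff_subgroup_fg H).2 hH
    exact Group.fg_of_surjective (f := e.symm.toMonoidHom) e.symm.surjective
  · have := fg_grigorchuk
    exact Group.fg_of_surjective (f := e.symm.toMonoidHom) e.symm.surjective
  · have : NeZero p := ⟨by omega⟩
    have := fg_lamplighter p
    exact Group.fg_of_surjective (f := e.symm.toMonoidHom) e.symm.surjective

theorem IsListedGroup.exists_linearlySeparated {G : Type u} [Group G]
    (h : IsListedGroup.{u, v} G) : ∃ C, LinearlySeparated C ({1}ᶜ : Set G) := by
  rcases h with h | ⟨h, hcomm⟩ | ⟨V, Γ, H, -, ⟨e⟩⟩ | ⟨⟨e⟩⟩ | ⟨p, hp, ⟨e⟩⟩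
  · exact ⟨_, linearlySeparated_of_finite G⟩
  · exact exists_linearlySeparated_of_comm G hcomm
  · exact ⟨_, (LinearlySeparated.graphProduct Γ fun _ => linearlySeparated_int).of_injective
      (H.subtype.comp e.toMonoidHom) (H.subtype_injective.comp e.injective)⟩
  · exact ⟨_, linearlySeparated_grigorchuk.of_injective e.toMonoidHom e.injective⟩
  · have : NeZero p := ⟨by omega⟩
    obtain ⟨C, hC⟩ := exists_linearlySeparated_lamplighter p
    exact ⟨C, hC.of_injective e.toMonoidHom e.injective⟩

end ActionGrowth

end

theorem proposition1p2 {ι : Type w} [Finite ι] (G : ι → Type u) [∀ i, Group (G i)]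
    (hG : ∀ i, ActionGrowth.IsListedGroup.{u, v} (G i)) :
    ActionGrowth.ClassCLin (Monoid.CoprodI G) ∧
      ∀ Γ : SimpleGraph ι, ActionGrowth.ClassCLin (ActionGrowth.GraphProduct Γ G) := by
  have hfg (Γ : SimpleGraph ι) := ActionGrowth.fg_graphProduct Γ fun i => (hG i).fg
  have hsep (Γ : SimpleGraph ι) :=
    ActionGrowth.exists_linearlySeparated_graphProduct Γ fun i => (hG i).exists_linearlySeparated
  refine ⟨?_, fun Γ => (hsep Γ).choose_spec.classCLin (hfg Γ)⟩
  let e := ActionGrowth.coprodEquivGraphProduct G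
  have := hfg ⊥
  exact ((hsep ⊥).choose_spec.of_injective e.toMonoidHom e.injective).classCLin
    (Group.fg_of_surjective (f := e.symm.toMonoidHom) e.symm.surjective)
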